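/- **Setting.** We work in $\mathrm{ZF}$, without the axiom of choice: $(V,\in)$ is an arbitrary model of $\mathrm{ZF}$, and all sets below are elements of $V$; "formula" means standard first-order formula. Let $\lambda$ be an infinite cardinal, and let $H=H(\lambda^+)$ be the set of all sets that are hereditarily of cardinality $\le\lambda$ (every element of the transitive closure of $\{x\}$ injects into $\lambda$). Let $\mathscr E$ be the set of all $\Delta_0$-embeddings $k:H\to H$ (maps $k\in V$ that preserve and reflect all $\Delta_0$ formulas). Let $P_{\lambda^{++}}(H)$ be the set of all subsets of $H$ of cardinality $<\lambda^{++}$ (those that inject into $\lambda^+$). Let $\mathscr E$ act by $$k^+(p)=\bigcup_{x\in H}k(p\cap x)\qquad(k\in\mathscr E,\ p\in P_{\lambda^{++}}(H)),$$ and give $\mathscr E$ the least topology for which the action map $\mathscr E\times P_{\lambda^{++}}(H)\to P_{\lambda^{++}}(H)$ is continuous, where $P_{\lambda^{++}}(H)$ is discrete. For $p\in P_{\lambda^{++}}(H)$ put $[j]_{\mathfrak r_p}=\{k\in\mathscr E: k^+(p)=j^+(p)\}$. The critical point $\mathrm{crit}(k)$ is the least ordinal moved by $k$. **Hypothesis.**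 Let $j:H\to H$, $j\in V$, $j\neq\mathrm{id}$, and $j^*:P(H)\to P(H)$ be such that the pair $(j,j^*)$ is $\Sigma^1_1$-elementary: for every formula $\exists Y_1\cdots\exists Y_m\,\varphi(\bar a,\bar X,\bar Y)$, in which $\varphi$ has only quantifiers over elements of $H$ and the $Y_i$ range over subsets of $H$, and for all $\bar a\in H$, $\bar X\subseteq H$, the formula holds of $(\bar a,\bar X)$ in $(H,P(H),\in)$ if and only if it holds of $(j(\bar a),j^*(\bar X))$. **Conclusion.** Then $j\in\mathscr E$, the set $k^+(p)$ belongs to $P_{\lambda^{++}}(H)$ for all $k\in\mathscr E$ and $p\in P_{\lambda^{++}}(H)$, and: 1. For every $p\in P_{\lambda^{++}}(H)$ the set $[j]_{\mathfrak r_p}$ is an open neighbourhood of $j$, and it contains some $k\neq j$ such that $\mathrm{crit}(k)<\mathrm{crit}(j)$ (both exist) and, provided that $V_\lambda\in H$, $k(k|_{V_\lambda})=j|_{V_\lambda}$. 2. More generally, every open set that contains $j$ contains such a $k$. 3. In particular the topology on $\mathscr E$ is not discrete. -/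

import Mathlib

open scoped FirstOrder Topology

namespace SetAction

universe u

/-! ### Formulas of set theory, with class variables -/

/-- The relation symbols: binary `∈`, and for each class variable `X : C` the unary `· ∈ X`. -/
inductive SetRel (C : Type) : ℕ → Type
  | mem : SetRel C 2
  | cls (X : C) : SetRel C 1

/-- The language of set theory with class variables indexed by `C` (and no function symbols). -/
def setLang (C : Type) : FirstOrder.Language.{0, 0} := ⟨fun _ => Empty, SetRel C⟩

/-- A membership relation together with values of the class variables interprets `setLang C`. -/
@[reducible] def clsStructure {C : Type} {D : Type u} [Membership D D] (W : C → Set D) :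
    (setLang C).Structure D where
  funMap := fun f _ => Empty.elim f
  RelMap := fun {_} R =>
    match R with
    | SetRel.mem => fun x => x 0 ∈ x 1
    | SetRel.cls X => fun x => x 0 ∈ W X

/-- Pure set theory: no class variables. -/
instance memStructure {D : Type u} [Membership D D] : (setLang Empty).Structure D :=
  clsStructure (fun X : Empty => X.elim)

/-- `Sat W φ a`: the first-order formula `φ` (quantifiers range over `D`) holds in `(D, ∈)` when
the class variables take the values `W` and the free set variables the values `a`. -/
def Sat {C : Type} {D : Type u} [Membership D D] {α : Type} (W : C → Set D)
    (φ : (setLang C).Formula α) (a : α → D) : Prop :=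
  @FirstOrder.Language.Formula.Realize (setLang C) D (clsStructure W) α φ a

/-- The `Δ₀` formulas of set theory: all quantifiers are bounded, `∀ x ∈ t, φ`. (Bounded existential
quantifiers are obtained by negation; `¬ φ` is `φ → ⊥`.) -/
inductive IsDelta0 {α : Type} : ∀ {n : ℕ}, (setLang Empty).BoundedFormula α n → Prop
  | falsum {n : ℕ} : IsDelta0 (FirstOrder.Language.BoundedFormula.falsum (n := n))
  | equal {n : ℕ} (t₁ t₂ : (setLang Empty).Term (α ⊕ Fin n)) :
      IsDelta0 (FirstOrder.Language.BoundedFormula.equal t₁ t₂)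
  | rel {n l : ℕ} (R : (setLang Empty).Relations l) (ts : Fin l → (setLang Empty).Term (α ⊕ Fin n)) :
      IsDelta0 (FirstOrder.Language.BoundedFormula.rel R ts)
  | imp {n : ℕ} {φ ψ : (setLang Empty).BoundedFormula α n} :
      IsDelta0 φ → IsDelta0 ψ → IsDelta0 (φ.imp ψ)
  | ball {n : ℕ} (t : α ⊕ Fin n) {φ : (setLang Empty).BoundedFormula α (n + 1)} :
      IsDelta0 φ →
      IsDelta0 (FirstOrder.Language.BoundedFormula.all
        ((FirstOrder.Language.BoundedFormula.rel (SetRel.mem : SetRel Empty 2)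
          ![FirstOrder.Language.Term.var (Sum.inr (Fin.last n)),
            FirstOrder.Language.Term.var (Sum.map id Fin.castSucc t)]).imp φ))

/-! ### Models of ZF, and basic notions inside such a model -/

/-- `(V, ∈)` is a model of `ZF` (no choice). The schemas are for classes and class functions that
are first-order definable over `(V, ∈)` with parameters. -/
structure IsModelZF (V : Type u) [Membership V V] : Prop where
  ext : ∀ x y : V, (∀ z : V, z ∈ x ↔ z ∈ y) → x = y
  foundation : ∀ x : V, (∃ y : V, y ∈ x) → ∃ y : V, y ∈ x ∧ ∀ z : V, z ∈ y → z ∉ x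
  pairing : ∀ x y : V, ∃ p : V, ∀ z : V, z ∈ p ↔ z = x ∨ z = y
  union : ∀ x : V, ∃ w : V, ∀ z : V, z ∈ w ↔ ∃ y : V, y ∈ x ∧ z ∈ y
  powerset : ∀ x : V, ∃ w : V, ∀ z : V, z ∈ w ↔ ∀ y : V, y ∈ z → y ∈ x
  infinity : ∃ w : V, (∃ e : V, e ∈ w ∧ ∀ z : V, z ∉ e) ∧
    ∀ x : V, x ∈ w → ∃ y : V, y ∈ w ∧ ∀ z : V, z ∈ y ↔ z ∈ x ∨ z = x
  separation : ∀ P : Set V, (Set.univ : Set V).Definable₁ (setLang Empty) P →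
    ∀ x : V, ∃ w : V, ∀ z : V, z ∈ w ↔ z ∈ x ∧ z ∈ P
  replacement : ∀ F : Set (V × V), (Set.univ : Set V).Definable₂ (setLang Empty) F →
    ∀ x : V, (∀ y : V, y ∈ x → ∃! z : V, (y, z) ∈ F) →
      ∃ w : V, ∀ z : V, z ∈ w ↔ ∃ y : V, y ∈ x ∧ (y, z) ∈ F

section Basic

variable {V : Type u} [Membership V V]

def IsTrans (x : V) : Prop := ∀ y : V, y ∈ x → ∀ z : V, z ∈ y → z ∈ x

/-- Von Neumann ordinals: transitive sets of transitive sets. -/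
def IsOrd (x : V) : Prop := IsTrans x ∧ ∀ y : V, y ∈ x → IsTrans y

/-- `p` is the Kuratowski pair `⟨x, y⟩ = {{x}, {x, y}}`. -/
def IsOPair (p x y : V) : Prop :=
  ∀ w : V, w ∈ p ↔ (∀ z : V, z ∈ w ↔ z = x) ∨ (∀ z : V, z ∈ w ↔ z = x ∨ z = y)

/-- `⟨x, y⟩ ∈ f`. -/
def PairMem (f x y : V) : Prop := ∃ p : V, p ∈ f ∧ IsOPair p x y

/-- In `V` there is an injection of `a` into `b`, that is, `|a| ≤ |b|`. -/
def CardLE (a b : V) : Prop :=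
  ∃ f : V, (∀ x : V, x ∈ a → ∃! y : V, y ∈ b ∧ PairMem f x y) ∧
    ∀ x x' y : V, x ∈ a → x' ∈ a → y ∈ b → PairMem f x y → PairMem f x' y → x = x'

/-- `lam` is an infinite cardinal: a nonzero limit ordinal that injects into none of its
elements. -/
def IsInfiniteCardinal (lam : V) : Prop :=
  IsOrd lam ∧ (∃ z : V, z ∈ lam) ∧ (∀ a : V, a ∈ lam → ∃ b : V, b ∈ lam ∧ a ∈ b) ∧
    ∀ a : V, a ∈ lam → ¬ CardLE lam a

/-- `l = lam⁺`: the least ordinal that does not inject into `lam`. -/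
def IsSuccCardinal (lam l : V) : Prop :=
  IsOrd l ∧ ¬ CardLE l lam ∧ ∀ a : V, a ∈ l → CardLE a lam

/-- `y` belongs to the transitive closure of `{x}`. -/
def InTrCl (x y : V) : Prop := ∀ t : V, IsTrans t → x ∈ t → y ∈ t

/-- `x` is hereditarily of cardinality `< lam⁺`, that is, `≤ lam`. -/
def IsHereditary (lam x : V) : Prop := ∀ y : V, InTrCl x y → CardLE y lam

/-- `v = V_a` for the ordinal `a`: there is a function `s`, defined at least on `a ∪ {a}`, with
`s(α) = {z : ∃ β ∈ α, z ⊆ s(β)}` and `s(a) = v`. -/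
def IsRankStage (a v : V) : Prop :=
  ∃ s : V, (∀ α : V, α ∈ a ∨ α = a → ∃! y : V, PairMem s α y) ∧
    (∀ α y : V, α ∈ a ∨ α = a → PairMem s α y →
      ∀ z : V, z ∈ y ↔ ∃ β w : V, β ∈ α ∧ PairMem s β w ∧ ∀ u : V, u ∈ z → u ∈ w) ∧
    PairMem s a v

/-- `H(lam⁺)`, as a type. -/
def HSet (lam : V) : Type u := {x : V // IsHereditary lam x}

instance (lam : V) : Membership (HSet lam) (HSet lam) := ⟨fun y x => x.1 ∈ y.1⟩

/-- `P(H(lam⁺))`: the elements of `V` that are subsets of `H(lam⁺)`. -/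
def HClass (lam : V) : Type u := {X : V // ∀ x : V, x ∈ X → IsHereditary lam x}

/-- The elements of a class, as a set in `H(lam⁺)`. -/
def HClass.carrier {lam : V} (X : HClass lam) : Set (HSet lam) := {x | x.1 ∈ X.1}

/-- `P_{lam⁺⁺}(H(lam⁺))`: subsets of `H(lam⁺)` of cardinality `< lam⁺⁺`, that is, `≤ lam⁺`. -/
def SmallClass (lam : V) : Type u :=
  {X : HClass lam // ∃ l : V, IsSuccCardinal lam l ∧ CardLE X.1 l}

def SmallClass.carrier {lam : V} (p : SmallClass lam) : Set (HSet lam) := p.1.carrier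

/-- The function `k : H(lam⁺) → H(lam⁺)` is an element of `V`. -/
def IsInternal {lam : V} (k : HSet lam → HSet lam) : Prop :=
  ∃ g : V, ∀ q : V, q ∈ g ↔ ∃ x : HSet lam, IsOPair q x.1 (k x).1

/-! ### Embeddings -/

/-- `k` preserves and reflects all `Δ₀` formulas. -/
def IsDelta0Embedding {lam : V} (k : HSet lam → HSet lam) : Prop :=
  ∀ (n : ℕ) (φ : (setLang Empty).Formula (Fin n)), IsDelta0 φ →
    ∀ a : Fin n → HSet lam, φ.Realize a ↔ φ.Realize (k ∘ a)

/-- `(j, jstar)`, with set part `j` and class part `jstar`, is `Σ¹₁`-elementary: it preserves and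
reflects every formula `∃ Y₁ … Yₘ, φ(a, X, Y)` about sets `a` in `H(lam⁺)` and classes
`X ⊆ H(lam⁺)`, where the `Yᵢ` range over classes `⊆ H(lam⁺)` and all quantifiers of `φ` range
over `H(lam⁺)`. -/
def IsSigma11Elementary {lam : V} (j : HSet lam → HSet lam) (jstar : HClass lam → HClass lam) :
    Prop :=
  ∀ (n c m : ℕ) (φ : (setLang (Fin c ⊕ Fin m)).Formula (Fin n))
    (a : Fin n → HSet lam) (X : Fin c → HClass lam),
    (∃ Y : Fin m → HClass lam,
      Sat (Sum.elim (fun i => (X i).carrier) fun i => (Y i).carrier) φ a) ↔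
    (∃ Y : Fin m → HClass lam,
      Sat (Sum.elim (fun i => (jstar (X i)).carrier) fun i => (Y i).carrier) φ (j ∘ a))

/-- Renaming of class variables, used only to regard pure formulas as formulas with classes. -/
def emptyHom (C : Type) : setLang Empty →ᴸ setLang C where
  onFunction := fun {_} f => Empty.elim f
  onRelation := fun {_} R =>
    match R with
    | SetRel.mem => SetRel.mem
    | SetRel.cls X => Empty.elim X

theorem sat_emptyHom {C α : Type} {D : Type u} [Membership D D] (W : C → Set D)
    (φ : (setLang Empty).Formula α) (a : α → D) :
    Sat W ((emptyHom C).onFormula φ) a ↔ φ.Realize a := by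
  let _ := clsStructure W
  have : (emptyHom C).IsExpansionOn D :=
    { map_onFunction := fun f _ => Empty.elim f
      map_onRelation := fun R _ => by
        cases R with
        | mem => rfl
        | cls X => exact X.elim }
  exact (emptyHom C).realize_onFormula φ

theorem IsSigma11Elementary.isDelta0Embedding {lam : V} {j : HSet lam → HSet lam}
    {jstar : HClass lam → HClass lam} (h : IsSigma11Elementary j jstar) :
    IsDelta0Embedding j := by
  intro n φ _ a
  have := h n 0 0 ((emptyHom _).onFormula φ) a Fin.elim0
  simp only [sat_emptyHom, exists_const] at this
  exact this

/-- `𝓔`: the (underlying set of the monoid of) `Δ₀`-embeddings `H(lam⁺) → H(lam⁺)` in `V`. -/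
def Emb (lam : V) : Type u := {k : HSet lam → HSet lam // IsInternal k ∧ IsDelta0Embedding k}

instance (lam : V) : CoeFun (Emb lam) fun _ => HSet lam → HSet lam := ⟨fun k => k.1⟩

/-- The set part of a `Σ¹₁`-elementary pair, as an element of `𝓔`. -/
def IsSigma11Elementary.toEmb {lam : V} {j : HSet lam → HSet lam}
    {jstar : HClass lam → HClass lam} (h : IsSigma11Elementary j jstar) (hj : IsInternal j) :
    Emb lam :=
  ⟨j, hj, h.isDelta0Embedding⟩

/-- `mu` is the critical point of `k`, the least ordinal moved by `k`. -/
def IsCrit {lam : V} (k : HSet lam → HSet lam) (mu : HSet lam) : Prop :=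
  IsOrd mu.1 ∧ k mu ≠ mu ∧ ∀ a : HSet lam, a ∈ mu → k a = a

/-- `r = k|_v`, the restriction of `k` to the set `v`. -/
def IsRestriction {lam : V} (k : HSet lam → HSet lam) (v r : HSet lam) : Prop :=
  ∀ q : V, q ∈ r.1 ↔ ∃ x : HSet lam, x ∈ v ∧ IsOPair q x.1 (k x).1

/-! ### The action and its topology -/

/-- `k⁺(p) = ⋃_{x ∈ H(lam⁺)} k(p ∩ x)`. -/
def Emb.act {lam : V} (k : Emb lam) (p : SmallClass lam) : Set (HSet lam) :=
  {y | ∃ x z : HSet lam, (∀ w : HSet lam, w ∈ z ↔ w ∈ p.carrier ∧ w ∈ x) ∧ y ∈ k z}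

/-- The class `[j]_{𝔯_p}` of `j` for the stabiliser relation `𝔯_p` of `p`. -/
def stabNhd {lam : V} (j : Emb lam) (p : SmallClass lam) : Set (Emb lam) :=
  {k | k.act p = j.act p}

/-- The least (coarsest) topology on `𝓔` that makes the action map
`𝓔 × P_{lam⁺⁺}(H(lam⁺)) → P_{lam⁺⁺}(H(lam⁺))` continuous, where `P_{lam⁺⁺}(H(lam⁺))` is discrete.
The target is written as the discrete space of all sets of elements of `H(lam⁺)`, which does not
affect continuity. In Mathlib's order the coarsest topology is the supremum. -/
@[reducible] def actTopology (lam : V) : TopologicalSpace (Emb lam) :=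
  sSup {t | @Continuous (Emb lam × SmallClass lam) (Set (HSet lam))
    (@instTopologicalSpaceProd _ _ t ⊥) ⊥ fun x => x.1.act x.2}

/-- `crit(k) < crit(j)`; both critical points exist. -/
def CritLT {lam : V} (k j : HSet lam → HSet lam) : Prop :=
  ∃ mu kappa : HSet lam, IsCrit k mu ∧ IsCrit j kappa ∧ mu ∈ kappa

/-- `k(k|_{V_lam}) = j|_{V_lam}`, provided that `V_lam ∈ H(lam⁺)`. -/
def ReflectsOn {lam : V} (k j : HSet lam → HSet lam) : Prop :=
  ∀ v : HSet lam, IsRankStage lam v.1 →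
    ∃ r s : HSet lam, IsRestriction k v r ∧ IsRestriction j v s ∧ k r = s

end Basic

end SetAction

open SetAction

/-! The map `j` is itself a witness of a `Σ¹₁` statement about images under `j`, and elementarity
pulls that statement back.

Put κ = crit(j), v = V_λ (when it lies in H), s = j|v and p' = j⁺(p). Consider the statement about
(κ, v, s, p, p'): some Δ₀-embedding k has crit(k) < κ, k(k|v) = s and k⁺(p) = p'. At the image
parameters (j(κ), j(v), j(s), j*(p), j*(p')) the choice k = j works: κ < j(κ), j(v) = v, j(j|v) =
j(s) and j⁺(j*(p)) = j*(j*(p)) = j*(p'). Hence the original parameters have a witness k as well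
(`exists_isReflection`, `exists_reflecting_emb`), and k ≠ j because the critical points differ.
Finitely many p are treated at once, which covers a basis of neighbourhoods of j.

Three facts support this.

On classes of size at most λ⁺ the class part j* agrees with j⁺ (`mem_jstar_iff`): an injection into
λ⁺ cuts p into pieces that are elements of H. Since j⁺(p) is again small (`exists_act_eq`), this
applies to p and to j*(p).

"k is a Δ₀-embedding" has to become part of a single formula. A monotone operator on classes,
`TruthStep`, has a fixed point (`exists_fixedPoint`), and every fixed point evaluates the codes of
actual Δ₀ formulas correctly. So it is enough to ask that k carry one fixed point Z into another one
Z' (`realize_iff_of_truth`); for j the pair Z, j*(Z) serves.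

No choice is used: each element of H injects into λ, which shows that j moves an ordinal (`eq_id`),
and j fixes λ and V_λ (`map_lamH`, `map_rankStage`). -/

namespace SetAction

universe u v

set_option synthInstance.maxSize 100000
set_option synthInstance.maxHeartbeats 400000

/-! ### First-order expressibility, decided by instance search. -/

section Expressibility

open FirstOrder FirstOrder.Language

variable {C : Type} {D : Type u} [Membership D D] {A : Type v} {G : Type v}

/-- `f` reads off one of the parameters `pv g` or one of the variables `w`. -/
class Tm (pv : G → A → D) (f : G → (ℕ → D) → D) : Prop where
  out : ∃ t : A ⊕ ℕ, ∀ g w, Sum.elim (pv g) w t = f g w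

/-- `P` is expressed by one first-order formula, whose class variables take the values `cv g`, and
whose free variables take the values `pv g` and `w`. -/
class Ex (cv : G → C → Set D) (pv : G → A → D) (P : G → (ℕ → D) → Prop) : Prop where
  out : ∃ φ : (setLang C).Formula (A ⊕ ℕ), ∀ g w,
    @Formula.Realize (setLang C) D (clsStructure (cv g)) _ φ (Sum.elim (pv g) w) ↔ P g w

variable {cv : G → C → Set D} {pv : G → A → D}

instance Tm.par (a : A) : Tm pv (fun g _ => pv g a) := ⟨Sum.inl a, fun _ _ => rfl⟩

instance Tm.var (i : ℕ) : Tm pv (fun _ w => w i) := ⟨Sum.inr i, fun _ _ => rfl⟩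

namespace Ex

variable {P Q : G → (ℕ → D) → Prop}

theorem of_iff (P : G → (ℕ → D) → Prop) [h : Ex cv pv P] (e : ∀ g w, P g w ↔ Q g w) :
    Ex cv pv Q := by
  have : P = Q := by funext g w; exact propext (e g w)
  exact this ▸ h

instance mem (f h : G → (ℕ → D) → D) [hf : Tm pv f] [hh : Tm pv h] :
    Ex cv pv (fun g w => f g w ∈ h g w) := by
  obtain ⟨s, hs⟩ := hf
  obtain ⟨t, ht⟩ := hh
  refine ⟨Relations.formula (L := setLang C) (n := 2) SetRel.mem ![Term.var s, Term.var t],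
    fun g w => ?_⟩
  let _ := clsStructure (cv g)
  refine (Formula.realize_rel (M := D)).trans ?_
  rw [← hs, ← ht]
  rfl

instance eq (f h : G → (ℕ → D) → D) [hf : Tm pv f] [hh : Tm pv h] :
    Ex cv pv (fun g w => f g w = h g w) := by
  obtain ⟨s, hs⟩ := hf
  obtain ⟨t, ht⟩ := hh
  refine ⟨Term.equal (Term.var s) (Term.var t), fun g w => ?_⟩
  let _ := clsStructure (cv g)
  rw [Formula.realize_equal, ← hs, ← ht]
  rfl

instance cls (X : C) (f : G → (ℕ → D) → D) [hf : Tm pv f] :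
    Ex cv pv (fun g w => f g w ∈ cv g X) := by
  obtain ⟨s, hs⟩ := hf
  refine ⟨Relations.formula (L := setLang C) (n := 1) (SetRel.cls X) ![Term.var s],
    fun g w => ?_⟩
  let _ := clsStructure (cv g)
  refine (Formula.realize_rel (M := D)).trans ?_
  rw [← hs]
  rfl

instance falsum : Ex cv pv (fun _ _ => False) := by
  refine ⟨⊥, fun g w => ?_⟩
  let _ := clsStructure (cv g)
  exact Iff.rfl

instance imp [hP : Ex cv pv P] [hQ : Ex cv pv Q] : Ex cv pv (fun g w => P g w → Q g w) := by
  obtain ⟨φ, hφ⟩ := hP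
  obtain ⟨ψ, hψ⟩ := hQ
  refine ⟨φ.imp ψ, fun g w => ?_⟩
  let _ := clsStructure (cv g)
  rw [Formula.realize_imp, hφ, hψ]

instance not [Ex cv pv P] : Ex cv pv (fun g w => ¬ P g w) :=
  inferInstanceAs (Ex cv pv (fun g w => P g w → False))

instance and [Ex cv pv P] [Ex cv pv Q] : Ex cv pv (fun g w => P g w ∧ Q g w) :=
  of_iff (fun g w => ¬ (P g w → ¬ Q g w)) fun g w => by tauto

instance or [Ex cv pv P] [Ex cv pv Q] : Ex cv pv (fun g w => P g w ∨ Q g w) :=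
  of_iff (fun g w => ¬ P g w → Q g w) fun g w => by tauto

instance iff [Ex cv pv P] [Ex cv pv Q] : Ex cv pv (fun g w => P g w ↔ Q g w) :=
  of_iff (fun g w => (P g w → Q g w) ∧ (Q g w → P g w))
    fun g w => by tauto

instance ne (f h : G → (ℕ → D) → D) [Tm pv f] [Tm pv h] :
    Ex cv pv (fun g w => f g w ≠ h g w) :=
  inferInstanceAs (Ex cv pv (fun g w => ¬ f g w = h g w))

/-- Replaces the variables of a formula by terms. -/
theorem subst {B : Type*} (ψ : (setLang C).Formula B) (t : B → G → (ℕ → D) → D)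
    (ht : ∀ b, Tm pv (t b)) :
    Ex cv pv (fun g w => @Formula.Realize _ D (clsStructure (cv g)) _ ψ (fun b => t b g w)) := by
  choose s hs using fun b => (ht b).out
  refine ⟨ψ.relabel s, fun g w => ?_⟩
  let _ := clsStructure (cv g)
  rw [Formula.realize_relabel]
  refine iff_of_eq (congrArg _ ?_)
  funext b
  exact hs b g w

/-- Variables are de Bruijn indices: under a quantifier the bound variable is `w 0` and all others
are shifted by one. -/
instance ex {P : G → (ℕ → D) → D → Prop} [hP : Ex cv pv (fun g w => P g (fun i => w (i + 1)) (w 0))] :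
    Ex cv pv (fun g w => ∃ x, P g w x) := by
  obtain ⟨φ, hφ⟩ := hP
  refine ⟨Formula.iExs Unit (φ.relabel
    (Sum.elim (fun a => Sum.inl (Sum.inl a))
      (fun i => Nat.casesOn i (Sum.inr ()) (fun i => Sum.inl (Sum.inr i))) :
        A ⊕ ℕ → (A ⊕ ℕ) ⊕ Unit)), fun g w => ?_⟩
  let _ := clsStructure (cv g)
  have key : ∀ x : D, Formula.Realize φ (Sum.elim (pv g) (fun i => Nat.casesOn i x w)) ↔
      P g w x := fun x => hφ g _
  rw [Formula.realize_iExs]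
  simp only [← key, Formula.realize_relabel]
  constructor
  · rintro ⟨y, hy⟩
    refine ⟨y (), ?_⟩
    convert hy using 1
    funext b
    rcases b with a | _ | i <;> rfl
  · rintro ⟨x, hx⟩
    refine ⟨fun _ => x, ?_⟩
    convert hx using 1
    funext b
    rcases b with a | _ | i <;> rfl

instance all {P : G → (ℕ → D) → D → Prop}
    [Ex cv pv (fun g w => P g (fun i => w (i + 1)) (w 0))] :
    Ex cv pv (fun g w => ∀ x, P g w x) :=
  of_iff (fun g w => ¬ ∃ x, ¬ P g w x) fun g w => by simp

/-- Unfolding `∃!` makes `P` occur twice, below one binder and below two; hence the two premises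
with different shifts. -/
instance exu {P : G → (ℕ → D) → D → Prop}
    [Ex cv pv (fun g w => P g (fun i => w (i + 1)) (w 0))]
    [Ex cv pv (fun g w => P g (fun i => w (i + 2)) (w 0))] :
    Ex cv pv (fun g w => ∃! x, P g w x) :=
  inferInstanceAs (Ex cv pv (fun g w => ∃ x, P g w x ∧ ∀ y, P g w y → y = x))

instance conj {n : ℕ} {P : Fin n → G → (ℕ → D) → Prop} [∀ i, Ex cv pv (P i)] :
    Ex cv pv (fun g w => ∀ i, P i g w) := by
  choose φ hφ using fun i => (inferInstance : Ex cv pv (P i)).out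
  refine ⟨Formula.iInf φ, fun g w => ?_⟩
  let _ := clsStructure (cv g)
  rw [Formula.realize_iInf]
  exact forall_congr' fun i => hφ i g w

end Ex

section Derived

variable {cv : G → C → Set D} {pv : G → A → D} (f₁ f₂ f₃ : G → (ℕ → D) → D)

/-- Substitutes terms for the variables. -/
theorem Ex.comp (P : G → (ℕ → D) → Prop) [hP : Ex cv pv P] (t : ℕ → G → (ℕ → D) → D)
    (ht : ∀ i, Tm pv (t i)) : Ex cv pv (fun g w => P g (fun i => t i g w)) := by
  obtain ⟨φ, hφ⟩ := hP
  have ht' : ∀ b : A ⊕ ℕ, Tm pv (Sum.elim (fun a g _ => pv g a) t b) := by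
    rintro (a | i)
    · exact Tm.par a
    · exact ht i
  have h := Ex.subst (cv := cv) φ _ ht'
  refine Ex.of_iff _ (h := h) fun g w => ?_
  rw [← hφ]
  refine iff_of_eq (congrArg _ ?_)
  funext b
  cases b <;> rfl

theorem Ex.comp₃ (Q : G → D → D → D → Prop) [Ex cv pv (fun g w => Q g (w 0) (w 1) (w 2))]
    [h₁ : Tm pv f₁] [h₂ : Tm pv f₂] [h₃ : Tm pv f₃] :
    Ex cv pv (fun g w => Q g (f₁ g w) (f₂ g w) (f₃ g w)) :=
  Ex.comp (fun g w => Q g (w 0) (w 1) (w 2))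
    (fun i => match i with | 0 => f₁ | 1 => f₂ | _ => f₃) fun i => match i with
      | 0 => h₁
      | 1 => h₂
      | _ + 2 => h₃

theorem Ex.comp₂ (Q : G → D → D → Prop) [Ex cv pv (fun g w => Q g (w 0) (w 1))]
    [h₁ : Tm pv f₁] [h₂ : Tm pv f₂] :
    Ex cv pv (fun g w => Q g (f₁ g w) (f₂ g w)) :=
  Ex.comp₃ f₁ f₂ f₂ fun g x y _ => Q g x y

theorem Ex.comp₁ (Q : G → D → Prop) [Ex cv pv (fun g w => Q g (w 0))]
    [h₁ : Tm pv f₁] :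
    Ex cv pv (fun g w => Q g (f₁ g w)) :=
  Ex.comp₃ f₁ f₁ f₁ fun g x _ _ => Q g x

variable [Tm pv f₁] [Tm pv f₂] [Tm pv f₃]

instance Ex.opair : Ex cv pv (fun g w => IsOPair (f₁ g w) (f₂ g w) (f₃ g w)) := by
  have : Ex cv pv (fun g w => IsOPair (w 0) (w 1) (w 2)) := by
    unfold IsOPair
    infer_instance
  exact Ex.comp₃ f₁ f₂ f₃ fun _ => IsOPair

instance Ex.pairMem : Ex cv pv (fun g w => PairMem (f₁ g w) (f₂ g w) (f₃ g w)) := by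
  have : Ex cv pv (fun g w => PairMem (w 0) (w 1) (w 2)) := by
    unfold PairMem
    infer_instance
  exact Ex.comp₃ f₁ f₂ f₃ fun _ => PairMem

instance Ex.isTrans : Ex cv pv (fun g w => IsTrans (f₁ g w)) := by
  have : Ex cv pv (fun g w => IsTrans (w 0)) := by
    unfold IsTrans
    infer_instance
  exact Ex.comp₁ f₁ fun _ => IsTrans

instance Ex.isOrd : Ex cv pv (fun g w => IsOrd (f₁ g w)) := by
  have : Ex cv pv (fun g w => IsOrd (w 0)) := by
    unfold IsOrd
    infer_instance
  exact Ex.comp₁ f₁ fun _ => IsOrd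

instance Ex.cardLE : Ex cv pv (fun g w => CardLE (f₁ g w) (f₂ g w)) := by
  have : Ex cv pv (fun g w => CardLE (w 0) (w 1)) := by
    unfold CardLE
    infer_instance
  exact Ex.comp₂ f₁ f₂ fun _ => CardLE

instance Ex.isHereditary : Ex cv pv (fun g w => IsHereditary (f₁ g w) (f₂ g w)) := by
  have : Ex cv pv (fun g w => IsHereditary (w 0) (w 1)) := by
    unfold IsHereditary InTrCl
    infer_instance
  exact Ex.comp₂ f₁ f₂ fun _ => IsHereditary

instance Ex.isRankStage : Ex cv pv (fun g w => IsRankStage (f₁ g w) (f₂ g w)) := by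
  have : Ex cv pv (fun g w => IsRankStage (w 0) (w 1)) := by
    unfold IsRankStage
    infer_instance
  exact Ex.comp₂ f₁ f₂ fun _ => IsRankStage

end Derived

end Expressibility
end SetAction

/-! ### Pairs, ordinals and cardinality in a model of ZF. -/

namespace SetAction

universe u v

set_option synthInstance.maxSize 100000
set_option synthInstance.maxHeartbeats 400000

/-- Extensionality, the empty set and adjunction `s ∪ {c}`. -/
structure Adj (D : Type u) [Membership D D] : Prop where
  ext : ∀ x y : D, (∀ z : D, z ∈ x ↔ z ∈ y) → x = y
  exists_empty : ∃ e : D, ∀ z : D, z ∉ e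
  exists_insert : ∀ s c : D, ∃ t : D, ∀ z : D, z ∈ t ↔ z ∈ s ∨ z = c

namespace Adj

variable {D : Type u} [Membership D D] (h : Adj D)

noncomputable def empty : D := h.exists_empty.choose

noncomputable def insert (s c : D) : D := (h.exists_insert s c).choose

theorem notMem_empty (z : D) : z ∉ h.empty := h.exists_empty.choose_spec z

@[simp] theorem mem_insert {s c z : D} : z ∈ h.insert s c ↔ z ∈ s ∨ z = c :=
  (h.exists_insert s c).choose_spec z

theorem eq_insert {s c t : D} (ht : ∀ z : D, z ∈ t ↔ z ∈ s ∨ z = c) : t = h.insert s c :=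
  h.ext _ _ fun z => by rw [ht, h.mem_insert]

theorem eq_empty {e : D} (he : ∀ z : D, z ∉ e) : e = h.empty :=
  h.ext _ _ fun z => iff_of_false (he z) (h.notMem_empty z)

noncomputable def upair (x y : D) : D := h.insert (h.insert h.empty x) y

@[simp] theorem mem_upair {x y z : D} : z ∈ h.upair x y ↔ z = x ∨ z = y := by
  simp [upair, h.notMem_empty]

/-- The Kuratowski pair. -/
noncomputable def op (x y : D) : D := h.upair (h.upair x x) (h.upair x y)

theorem upair_iff {w x y : D} : (∀ z : D, z ∈ w ↔ z = x ∨ z = y) ↔ w = h.upair x y :=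
  ⟨fun e => h.ext _ _ fun z => by rw [e, h.mem_upair], fun e z => by rw [e, h.mem_upair]⟩

theorem mem_op {x y w : D} : w ∈ h.op x y ↔ w = h.upair x x ∨ w = h.upair x y := h.mem_upair

theorem isOPair_iff {q x y : D} : IsOPair q x y ↔ q = h.op x y := by
  have e : ∀ w : D, ((∀ z : D, z ∈ w ↔ z = x) ∨ (∀ z : D, z ∈ w ↔ z = x ∨ z = y)) ↔
      w ∈ h.op x y := by
    intro w
    rw [h.mem_op, ← h.upair_iff, ← h.upair_iff]
    simp
  constructor
  · exact fun hq => h.ext _ _ fun w => by rw [hq w, e]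
  · rintro rfl w
    exact (e w).symm

theorem pairMem_iff {f x y : D} : PairMem f x y ↔ h.op x y ∈ f := by
  simp [PairMem, h.isOPair_iff]

theorem upair_inj_right {x y y' : D} (e : h.upair x y = h.upair x y') : y = y' := by
  have h₁ : y ∈ h.upair x y' := e ▸ h.mem_upair.2 (Or.inr rfl)
  have h₂ : y' ∈ h.upair x y := e ▸ h.mem_upair.2 (Or.inr rfl)
  rcases h.mem_upair.1 h₁ with rfl | rfl
  · rcases h.mem_upair.1 h₂ with rfl | rfl <;> rfl
  · rfl

theorem upair_self_eq {x y z : D} (e : h.upair x x = h.upair y z) : x = y ∧ x = z := by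
  have h₁ : y ∈ h.upair x x := e ▸ h.mem_upair.2 (Or.inl rfl)
  have h₂ : z ∈ h.upair x x := e ▸ h.mem_upair.2 (Or.inr rfl)
  simp only [mem_upair, or_self] at h₁ h₂
  exact ⟨h₁.symm, h₂.symm⟩

@[simp] theorem op_inj {x y x' y' : D} : h.op x y = h.op x' y' ↔ x = x' ∧ y = y' := by
  refine ⟨fun e => ?_, fun ⟨hx, hy⟩ => hx ▸ hy ▸ rfl⟩
  have hx : x = x' := by
    have : h.upair x x ∈ h.op x' y' := e ▸ h.mem_op.2 (Or.inl rfl)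
    rcases h.mem_op.1 this with h₁ | h₁
    · exact (h.upair_self_eq h₁).1
    · exact (h.upair_self_eq h₁).1
  subst hx
  exact ⟨rfl, h.upair_inj_right (h.upair_inj_right e)⟩

end Adj

variable {V : Type u} [Membership V V]

/-- `P` is first-order definable over `(V, ∈)` with parameters. -/
abbrev DefV (P : (ℕ → V) → Prop) : Prop :=
  Ex (C := Empty) (A := V) (G := PUnit.{u + 1}) (fun _ X => X.elim) (fun _ a => a) (fun _ w => P w)

theorem DefV.realize {P : (ℕ → V) → Prop} (h : DefV P) :
    ∃ φ : (setLang Empty).Formula (V ⊕ ℕ), ∀ w, φ.Realize (Sum.elim id w) ↔ P w := by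
  obtain ⟨φ, hφ⟩ := h
  refine ⟨φ, fun w => ?_⟩
  rw [← hφ ⟨⟩ w]
  exact Iff.rfl

theorem DefV.definable₁ {P : V → Prop} (h : DefV fun w : ℕ → V => P (w 0)) :
    (Set.univ : Set V).Definable₁ (setLang Empty) {x | P x} := by
  obtain ⟨φ, hφ⟩ := h.realize
  refine Set.definable_iff_exists_formula_sum.2
    ⟨φ.relabel (Sum.map (fun a => ⟨a, trivial⟩) fun _ => 0), ?_⟩
  ext v
  change P (v 0) ↔ _
  rw [← hφ fun _ => v 0]
  simp only [Set.mem_ofPred_eq, FirstOrder.Language.Formula.realize_relabel]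
  refine iff_of_eq (congrArg _ ?_)
  funext b
  cases b <;> rfl

theorem IsOrd.mem {x y : V} (h : IsOrd x) (hy : y ∈ x) : IsOrd y :=
  ⟨h.2 y hy, fun z hz => h.2 z (h.1 y hy z hz)⟩

namespace IsModelZF

variable (hV : IsModelZF V)
include hV

theorem sep (P : V → Prop) [hP : DefV fun w : ℕ → V => P (w 0)] (x : V) :
    ∃ w : V, ∀ z : V, z ∈ w ↔ z ∈ x ∧ P z :=
  hV.separation {x | P x} hP.definable₁ x

theorem adj : Adj V where
  ext := hV.ext
  exists_empty := by
    obtain ⟨w, ⟨e, -, he⟩, -⟩ := hV.infinity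
    exact ⟨e, he⟩
  exists_insert s c := by
    obtain ⟨p, hp⟩ := hV.pairing c c
    obtain ⟨q, hq⟩ := hV.pairing s p
    obtain ⟨t, ht⟩ := hV.union q
    refine ⟨t, fun z => ?_⟩
    rw [ht]
    constructor
    · rintro ⟨y, hy, hz⟩
      rcases (hq y).1 hy with rfl | rfl
      · exact Or.inl hz
      · exact Or.inr (by simpa using (hp z).1 hz)
    · rintro (hz | rfl)
      · exact ⟨s, (hq s).2 (Or.inl rfl), hz⟩
      · exact ⟨p, (hq p).2 (Or.inr rfl), (hp z).2 (Or.inl rfl)⟩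

theorem minimal (P : V → Prop) [DefV fun w : ℕ → V => P (w 0)] (t : V)
    (h : ∃ x : V, x ∈ t ∧ P x) : ∃ x : V, x ∈ t ∧ P x ∧ ∀ y : V, y ∈ x → y ∈ t → ¬ P y := by
  obtain ⟨w, hw⟩ := hV.sep P t
  obtain ⟨x, hx⟩ := h
  obtain ⟨y, hy, hmin⟩ := hV.foundation w ⟨x, (hw x).2 hx⟩
  refine ⟨y, ((hw y).1 hy).1, ((hw y).1 hy).2, fun z hz hzt hPz => hmin z hz ((hw z).2 ⟨hzt, hPz⟩)⟩

/-- Restricting the induction to a transitive set `t` lets set foundation suffice, without forming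
transitive closures. -/
theorem induct (P : V → Prop) [DefV fun w : ℕ → V => P (w 0)] {t : V} (ht : IsTrans t)
    (h : ∀ x : V, x ∈ t → (∀ y : V, y ∈ x → P y) → P x) {x : V} (hx : x ∈ t) : P x := by
  by_contra hP
  obtain ⟨y, hy, hPy, hmin⟩ := hV.minimal (fun x => ¬ P x) t ⟨x, hx, hP⟩
  exact hPy (h y hy fun z hz => not_not.1 (hmin z hz (ht y hy z hz)))

theorem mem_irrefl (x : V) : x ∉ x := by
  intro h
  obtain ⟨y, hy, hmin⟩ := hV.foundation (hV.adj.upair x x) ⟨x, by simp⟩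
  have e : y = x := by simpa using hy
  exact hmin x (e ▸ h) (by simp)

theorem mem_asymm {x y : V} (h : x ∈ y) : y ∉ x := by
  intro h'
  obtain ⟨z, hz, hmin⟩ := hV.foundation (hV.adj.upair x y) ⟨x, by simp⟩
  rcases hV.adj.mem_upair.1 hz with rfl | rfl
  · exact hmin y h' (by simp)
  · exact hmin x h (by simp)

/-- Kuratowski pairs over a ∪ b lie in its double power set, so separation yields the relation. -/
theorem exists_rel (R : V → V → Prop) [DefV fun w : ℕ → V => R (w 0) (w 1)] (a b : V) :
    ∃ f : V, ∀ q : V, q ∈ f ↔ ∃ x y : V, x ∈ a ∧ y ∈ b ∧ R x y ∧ IsOPair q x y := by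
  obtain ⟨c, hc⟩ := hV.union (hV.adj.upair a b)
  obtain ⟨p, hp⟩ := hV.powerset c
  obtain ⟨pp, hpp⟩ := hV.powerset p
  have : DefV fun w : ℕ → V => R (w 1) (w 0) := Ex.comp₂ _ _ fun _ => R
  obtain ⟨f, hf⟩ := hV.sep (fun q => ∃ x y : V, x ∈ a ∧ y ∈ b ∧ R x y ∧ IsOPair q x y) pp
  refine ⟨f, fun q => ?_⟩
  rw [hf, and_iff_right_iff_imp]
  rintro ⟨x, y, hx, hy, -, hq⟩
  rw [hV.adj.isOPair_iff] at hq
  have hx' : x ∈ c := (hc x).2 ⟨a, by simp, hx⟩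
  have hy' : y ∈ c := (hc y).2 ⟨b, by simp, hy⟩
  rw [hpp]
  intro w hw
  rw [hp]
  intro z hz
  rw [hq, hV.adj.mem_op] at hw
  rcases hw with rfl | rfl
  · rcases hV.adj.mem_upair.1 hz with rfl | rfl <;> exact hx'
  · rcases hV.adj.mem_upair.1 hz with rfl | rfl
    · exact hx'
    · exact hy'

theorem cardLE_of (R : V → V → Prop) [DefV fun w : ℕ → V => R (w 0) (w 1)] {a b : V}
    (tot : ∀ x : V, x ∈ a → ∃ y : V, y ∈ b ∧ R x y)
    (fn : ∀ x y y' : V, x ∈ a → y ∈ b → y' ∈ b → R x y → R x y' → y = y')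
    (inj : ∀ x x' y : V, x ∈ a → x' ∈ a → y ∈ b → R x y → R x' y → x = x') : CardLE a b := by
  obtain ⟨f, hf⟩ := hV.exists_rel R a b
  have key : ∀ x y : V, PairMem f x y ↔ x ∈ a ∧ y ∈ b ∧ R x y := by
    intro x y
    rw [hV.adj.pairMem_iff, hf]
    simp only [hV.adj.isOPair_iff, hV.adj.op_inj]
    constructor
    · rintro ⟨x', y', hx, hy, hR, rfl, rfl⟩
      exact ⟨hx, hy, hR⟩
    · rintro ⟨hx, hy, hR⟩
      exact ⟨x, y, hx, hy, hR, rfl, rfl⟩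
  refine ⟨f, fun x hx => ?_, fun x x' y hx hx' hy h h' => ?_⟩
  · obtain ⟨y, hy, hR⟩ := tot x hx
    refine ⟨y, ⟨hy, (key x y).2 ⟨hx, hy, hR⟩⟩, fun y' ⟨hy', h'⟩ => ?_⟩
    exact fn x y' y hx hy' hy ((key _ _).1 h').2.2 hR
  · exact inj x x' y hx hx' hy ((key _ _).1 h).2.2 ((key _ _).1 h').2.2

omit hV in
theorem cardLE_subset {a b l : V} (h : CardLE b l) (hab : ∀ x : V, x ∈ a → x ∈ b) : CardLE a l := by
  obtain ⟨f, h₁, h₂⟩ := h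
  exact ⟨f, fun x hx => h₁ x (hab x hx), fun x x' y hx hx' => h₂ x x' y (hab x hx) (hab x' hx')⟩

theorem cardLE_refl_of_subset {a b : V} (hab : ∀ x : V, x ∈ a → x ∈ b) : CardLE a b :=
  hV.cardLE_of (fun x y => x = y) (fun x hx => ⟨x, hab x hx, rfl⟩)
    (fun _ _ _ _ _ _ h h' => h.symm.trans h') (fun _ _ _ _ _ _ h h' => h.trans h'.symm)

theorem cardLE_trans {a b c : V} (h : CardLE a b) (h' : CardLE b c) : CardLE a c := by
  obtain ⟨f, f₁, f₂⟩ := h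
  obtain ⟨g, g₁, g₂⟩ := h'
  refine hV.cardLE_of (fun x z => ∃ y, y ∈ b ∧ PairMem f x y ∧ PairMem g y z)
    (fun x hx => ?_) ?_ ?_
  · obtain ⟨y, ⟨hy, hxy⟩, -⟩ := f₁ x hx
    obtain ⟨z, ⟨hz, hyz⟩, -⟩ := g₁ y hy
    exact ⟨z, hz, y, hy, hxy, hyz⟩
  · rintro x z z' hx hz hz' ⟨y, hy, hxy, hyz⟩ ⟨y', hy', hxy', hyz'⟩
    obtain rfl := (f₁ x hx).unique ⟨hy, hxy⟩ ⟨hy', hxy'⟩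
    exact (g₁ y hy).unique ⟨hz, hyz⟩ ⟨hz', hyz'⟩
  · rintro x x' z hx hx' hz ⟨y, hy, hxy, hyz⟩ ⟨y', hy', hxy', hyz'⟩
    obtain rfl := g₂ y y' z hy hy' hz hyz hyz'
    exact f₂ x x' y hx hx' hy hxy hxy'

theorem isTrans_insert {x : V} (h : IsTrans x) : IsTrans (hV.adj.insert x x) := by
  intro y hy z hz
  rw [hV.adj.mem_insert] at hy ⊢
  rcases hy with hy | rfl
  · exact Or.inl (h y hy z hz)
  · exact Or.inl hz

theorem isOrd_insert {x : V} (h : IsOrd x) : IsOrd (hV.adj.insert x x) := by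
  refine ⟨hV.isTrans_insert h.1, fun y hy => ?_⟩
  rcases hV.adj.mem_insert.1 hy with hy | rfl
  · exact h.2 y hy
  · exact h.1

/-- Double ∈-induction inside the transitive sets x ∪ {x} and y ∪ {y}. If neither ordinal is equal
to or below an element of the other, the induction hypotheses force them to have the same elements.
-/
theorem trichotomy {x y : V} (hx : IsOrd x) (hy : IsOrd y) : x ∈ y ∨ x = y ∨ y ∈ x := by
  have hs := hV.isTrans_insert hx.1
  have ht := hV.isTrans_insert hy.1
  have hso := (hV.isOrd_insert hx).2
  have hto := (hV.isOrd_insert hy).2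
  set s := hV.adj.insert x x
  set t := hV.adj.insert y y
  refine hV.induct (fun x => ∀ y : V, y ∈ t → x ∈ y ∨ x = y ∨ y ∈ x) hs (fun a ha iha b hb => ?_)
    (hV.adj.mem_insert.2 (Or.inr rfl)) y (hV.adj.mem_insert.2 (Or.inr rfl))
  refine hV.induct (fun b => a ∈ b ∨ a = b ∨ b ∈ a) ht (fun b hb ihb => ?_) hb
  by_cases h₁ : ∃ c : V, c ∈ b ∧ (a = c ∨ a ∈ c)
  · obtain ⟨c, hc, rfl | h⟩ := h₁
    · exact Or.inl hc
    · exact Or.inl (hto b hb c hc a h)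
  by_cases h₂ : ∃ c : V, c ∈ a ∧ (c = b ∨ b ∈ c)
  · obtain ⟨c, hc, rfl | h⟩ := h₂
    · exact Or.inr (Or.inr hc)
    · exact Or.inr (Or.inr (hso a ha c hc b h))
  refine Or.inr (Or.inl (hV.ext _ _ fun z => ⟨fun hz => ?_, fun hz => ?_⟩))
  · rcases iha z hz b hb with h | h | h
    · exact h
    · exact absurd ⟨z, hz, Or.inl h⟩ h₂
    · exact absurd ⟨z, hz, Or.inr h⟩ h₂
  · rcases ihb z hz with h | h | h
    · exact absurd ⟨z, hz, Or.inr h⟩ h₁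
    · exact absurd ⟨z, hz, Or.inl h⟩ h₁
    · exact h

theorem succ_mem {l a : V} (hl : IsInfiniteCardinal l) (ha : a ∈ l) : hV.adj.insert a a ∈ l := by
  obtain ⟨b, hb, hab⟩ := hl.2.2.1 a ha
  have hs := hV.isOrd_insert (IsOrd.mem hl.1 ha)
  rcases hV.trichotomy hs (IsOrd.mem hl.1 hb) with h | h | h
  · exact hl.1.1 b hb _ h
  · exact h ▸ hb
  · rcases hV.adj.mem_insert.1 h with h | rfl
    · exact absurd h (hV.mem_asymm hab)
    · exact absurd hab (hV.mem_irrefl _)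

theorem empty_mem {l : V} (hl : IsInfiniteCardinal l) : hV.adj.empty ∈ l := by
  obtain ⟨z, hz, hmin⟩ := hV.foundation l hl.2.1
  have : z = hV.adj.empty := hV.adj.eq_empty fun y hy => hmin y hy (hl.1.1 z hz y hy)
  exact this ▸ hz

/-- Hilbert's hotel: `c` goes to 0, and every other element to the successor of its old value. -/
theorem cardLE_insert {l s : V} (hl : IsInfiniteCardinal l) (h : CardLE s l) (c : V) :
    CardLE (hV.adj.insert s c) l := by
  obtain ⟨f, f₁, f₂⟩ := h
  have hsucc : ∀ m n : V, (∀ z : V, z ∈ n ↔ z ∈ m ∨ z = m) ↔ n = hV.adj.insert m m := fun m n =>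
    ⟨fun e => hV.adj.eq_insert e, fun e z => by rw [e, hV.adj.mem_insert]⟩
  have hinj : ∀ m m' : V, hV.adj.insert m m = hV.adj.insert m' m' → m = m' := by
    intro m m' e
    have h₁ : m ∈ hV.adj.insert m' m' := e ▸ hV.adj.mem_insert.2 (Or.inr rfl)
    have h₂ : m' ∈ hV.adj.insert m m := e ▸ hV.adj.mem_insert.2 (Or.inr rfl)
    rw [hV.adj.mem_insert] at h₁ h₂
    rcases h₁ with h₁ | h₁
    · rcases h₂ with h₂ | h₂
      · exact absurd h₁ (hV.mem_asymm h₂)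
      · exact h₂.symm
    · exact h₁
  have hne : ∀ m : V, hV.adj.insert m m ≠ hV.adj.empty := fun m e =>
    hV.adj.notMem_empty m (e ▸ hV.adj.mem_insert.2 (Or.inr rfl))
  refine hV.cardLE_of (fun u n => (u = c ∧ n = hV.adj.empty) ∨
    (u ≠ c ∧ ∃ m, m ∈ l ∧ PairMem f u m ∧ ∀ z : V, z ∈ n ↔ z ∈ m ∨ z = m)) ?_ ?_ ?_
  · intro u hu
    by_cases huc : u = c
    · exact ⟨_, hV.empty_mem hl, Or.inl ⟨huc, rfl⟩⟩
    · have hu' : u ∈ s := by simpa [huc] using hu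
      obtain ⟨m, ⟨hm, hum⟩, -⟩ := f₁ u hu'
      exact ⟨_, hV.succ_mem hl hm, Or.inr ⟨huc, m, hm, hum, (hsucc _ _).2 rfl⟩⟩
  · rintro u n n' hu - - (⟨h, rfl⟩ | ⟨h, m, hm, hum, hn⟩) (⟨h', rfl⟩ | ⟨h', m', hm', hum', hn'⟩)
    · rfl
    · exact absurd h h'
    · exact absurd h' h
    · have hu' : u ∈ s := by simpa [h] using hu
      obtain rfl := (f₁ u hu').unique ⟨hm, hum⟩ ⟨hm', hum'⟩
      rw [(hsucc _ _).1 hn, (hsucc _ _).1 hn']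
  · rintro u u' n hu hu' - (⟨h, h₀⟩ | ⟨h, m, hm, hum, hn⟩) (⟨h', h₀'⟩ | ⟨h', m', hm', hum', hn'⟩)
    · rw [h, h']
    · exact absurd (((hsucc _ _).1 hn').symm.trans h₀) (hne _)
    · exact absurd (((hsucc _ _).1 hn).symm.trans h₀') (hne _)
    · have hu₁ : u ∈ s := by simpa [h] using hu
      have hu₂ : u' ∈ s := by simpa [h'] using hu'
      obtain rfl := hinj _ _ (((hsucc _ _).1 hn).symm.trans ((hsucc _ _).1 hn'))
      exact f₂ u u' m hu₁ hu₂ hm hum hum'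

end IsModelZF

end SetAction

/-! ### Definability over H: class comprehension, induction and fixed points. -/

namespace SetAction

universe u v

set_option synthInstance.maxSize 100000
set_option synthInstance.maxHeartbeats 400000

/-- The sequence `x, v 0, v 1, …`. -/
def cons {D : Type u} (x : D) (v : ℕ → D) : ℕ → D
  | 0 => x
  | i + 1 => v i

variable {V : Type u} [Membership V V] {lam Hs : V}

/-- `P` is expressed over `H(lam⁺)` by one formula with class variables. -/
abbrev DefH {C : Type} (P : (C → Set (HSet lam)) → (ℕ → HSet lam) → Prop) : Prop :=
  Ex (A := PEmpty.{u + 1}) (G := C → Set (HSet lam)) (fun W => W) (fun _ a => a.elim) P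

theorem IsHereditary.mem {x y : V} (h : IsHereditary lam x) (hy : y ∈ x) : IsHereditary lam y :=
  fun z hz => h z fun t ht hx => hz t ht (ht x hx y hy)

theorem IsHereditary.cardLE {x : V} (h : IsHereditary lam x) : CardLE x lam :=
  h x fun _ _ hx => hx

/-- `(V, ∈)` is a model of `ZF` in which `lam` is an infinite cardinal and `Hs` is the set
`H(lam⁺)`. -/
structure Ctx (lam Hs : V) : Prop where
  zf : IsModelZF V
  card : IsInfiniteCardinal lam
  mem_iff : ∀ x : V, x ∈ Hs ↔ IsHereditary lam x

/-- H is a set because it is the domain of the set `j`; two unions recover the coordinates of its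
pairs. -/
theorem exists_ctx (hV : IsModelZF V) (hlam : IsInfiniteCardinal lam) {j : HSet lam → HSet lam}
    (hj : IsInternal j) : ∃ Hs : V, Ctx lam Hs := by
  obtain ⟨g, hg⟩ := hj
  obtain ⟨g₁, hg₁⟩ := hV.union g
  obtain ⟨g₂, hg₂⟩ := hV.union g₁
  obtain ⟨s, hs⟩ := hV.sep (fun x => IsHereditary lam x) g₂
  refine ⟨s, hV, hlam, fun x => ?_⟩
  rw [hs, and_iff_right_iff_imp]
  intro hx
  refine (hg₂ x).2 ⟨hV.adj.upair x x, (hg₁ _).2 ⟨hV.adj.op x (j ⟨x, hx⟩).1, ?_, ?_⟩, ?_⟩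
  · exact (hg _).2 ⟨⟨x, hx⟩, hV.adj.isOPair_iff.2 rfl⟩
  · exact hV.adj.mem_op.2 (Or.inl rfl)
  · simp

theorem DefV.subst {B : Type*} (ψ : (setLang Empty).Formula B) (t : B → (ℕ → V) → V)
    (ht : ∀ b, Tm (A := V) (G := PUnit.{u + 1}) (fun _ a => a) (fun _ => t b)) :
    DefV fun w => ψ.Realize fun b => t b w :=
  Ex.subst ψ (fun b _ => t b) ht

section Relativization

open FirstOrder FirstOrder.Language

/-- Values in `V` for the variables of a relativized formula. -/
def relEnv {C α : Type*} (Hs : V) (W : C → V) (a : α → HSet lam) : Option (C ⊕ α) → V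
  | none => Hs
  | some (Sum.inl c) => W c
  | some (Sum.inr i) => (a i).1

/-- Quantifiers over H become quantifiers over V bounded by `Hs`, the value of the variable `none`,
and class variables become set variables. Separation in V can then be applied to formulas about
classes of H. -/
theorem exists_relativization (h : Ctx lam Hs) {C : Type} {α : Type*} {n : ℕ}
    (φ : (setLang C).BoundedFormula α n) :
    ∃ ψ : (setLang Empty).BoundedFormula (Option (C ⊕ α)) n,
      ∀ (W : C → V) (a : α → HSet lam) (xs : Fin n → HSet lam),
        ψ.Realize (relEnv Hs W a) (fun i => (xs i).1) ↔
          @BoundedFormula.Realize (setLang C) (HSet lam) (clsStructure fun c => {x | x.1 ∈ W c})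
            α n φ a xs := by
  have hvar : ∀ {m : ℕ} (t : (setLang C).Term (α ⊕ Fin m)), ∃ b, t = Term.var b := by
    intro m t
    cases t with
    | var b => exact ⟨b, rfl⟩
    | func f _ => exact Empty.elim f
  have hval : ∀ {m : ℕ} (b : α ⊕ Fin m) (W : C → V) (a : α → HSet lam) (xs : Fin m → HSet lam),
      Sum.elim (relEnv Hs W a) (fun i => (xs i).1) (Sum.map (fun i => some (Sum.inr i)) id b) =
        (Sum.elim a xs b).1 := by
    intro m b W a xs
    cases b <;> rfl
  induction φ with
  | falsum => exact ⟨BoundedFormula.falsum, fun _ _ _ => Iff.rfl⟩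
  | equal t₁ t₂ =>
    obtain ⟨b₁, rfl⟩ := hvar t₁
    obtain ⟨b₂, rfl⟩ := hvar t₂
    refine ⟨BoundedFormula.equal (Term.var (Sum.map (fun i => some (Sum.inr i)) id b₁))
      (Term.var (Sum.map (fun i => some (Sum.inr i)) id b₂)), fun W a xs => ?_⟩
    simp only [BoundedFormula.Realize, Term.realize_var, hval]
    exact Subtype.ext_iff.symm
  | rel R ts =>
    choose b hb using fun i => hvar (ts i)
    cases R with
    | mem =>
      refine ⟨BoundedFormula.rel (SetRel.mem : SetRel Empty 2)
        fun i => Term.var (Sum.map (fun i => some (Sum.inr i)) id (b i)), fun W a xs => ?_⟩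
      simp only [BoundedFormula.Realize, Term.realize_var, hval, hb]
      exact Iff.rfl
    | cls X =>
      refine ⟨BoundedFormula.rel (SetRel.mem : SetRel Empty 2)
        ![Term.var (Sum.map (fun i => some (Sum.inr i)) id (b 0)),
          Term.var (Sum.inl (some (Sum.inl X)))], fun W a xs => ?_⟩
      simp only [BoundedFormula.Realize, hb]
      change Sum.elim (relEnv Hs W a) (fun i => (xs i).1)
        (Sum.map (fun i => some (Sum.inr i)) id (b 0)) ∈ W X ↔ (Sum.elim a xs (b 0)).1 ∈ W X
      rw [hval]
  | imp φ₁ φ₂ ih₁ ih₂ =>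
    obtain ⟨ψ₁, h₁⟩ := ih₁
    obtain ⟨ψ₂, h₂⟩ := ih₂
    refine ⟨ψ₁.imp ψ₂, fun W a xs => ?_⟩
    simp only [BoundedFormula.Realize]
    rw [h₁, h₂]
  | @all m φ ih =>
    obtain ⟨ψ, hψ⟩ := ih
    refine ⟨((BoundedFormula.rel (SetRel.mem : SetRel Empty 2)
      ![Term.var (Sum.inr (Fin.last m)), Term.var (Sum.inl none)]).imp ψ).all, fun W a xs => ?_⟩
    simp only [BoundedFormula.Realize]
    have key : ∀ x : HSet lam, (Fin.snoc (fun i => (xs i).1) x.1 : Fin (m + 1) → V) =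
        fun i => ((Fin.snoc xs x : Fin (m + 1) → HSet lam) i).1 := by
      intro x
      funext i
      refine Fin.lastCases ?_ (fun i => ?_) i <;> simp
    constructor
    · intro H x
      rw [← hψ, ← key]
      refine H x.1 ?_
      change (Fin.snoc (fun i => (xs i).1) x.1 : Fin (m + 1) → V) (Fin.last m) ∈ Hs
      rw [Fin.snoc_last]
      exact (h.mem_iff _).2 x.2
    · intro H x hx
      change (Fin.snoc (fun i => (xs i).1) x : Fin (m + 1) → V) (Fin.last m) ∈ Hs at hx
      rw [Fin.snoc_last] at hx
      let y : HSet lam := ⟨x, (h.mem_iff _).1 hx⟩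
      have := H y
      rw [← hψ, ← key] at this
      exact this

theorem DefH.relativize (h : Ctx lam Hs) {C : Type}
    {P : (C → Set (HSet lam)) → (ℕ → HSet lam) → Prop} (hP : DefH P) :
    ∃ ψ : (setLang Empty).Formula (Option (C ⊕ ℕ)), ∀ (W : C → V) (v : ℕ → HSet lam),
      ψ.Realize (relEnv Hs W v) ↔ P (fun c => {x | x.1 ∈ W c}) v := by
  obtain ⟨φ, hφ⟩ := hP
  obtain ⟨ψ, hψ⟩ := exists_relativization h φ
  refine ⟨Formula.relabel (Option.map (Sum.map id (Sum.elim (fun a => a.elim) id))) ψ,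
    fun W v => ?_⟩
  rw [Formula.realize_relabel, ← hφ]
  have e := hψ W (Sum.elim (fun a => a.elim) v) default
  refine Iff.trans ?_ e
  unfold Formula.Realize
  refine iff_of_eq (congrArg₂ _ ?_ (Subsingleton.elim _ _))
  funext o
  rcases o with _ | c | a | i
  · rfl
  · rfl
  · exact a.elim
  · rfl

end Relativization

namespace Ctx

variable (h : Ctx lam Hs)
include h

/-- Class comprehension for `H(lam⁺)`. -/
theorem exists_class {C : Type} (P : (C → Set (HSet lam)) → (ℕ → HSet lam) → Prop) [hP : DefH P]
    (W : C → HClass lam) (v : ℕ → HSet lam) :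
    ∃ X : HClass lam, ∀ x : HSet lam, x ∈ X.carrier ↔ P (fun c => (W c).carrier) (cons x v) := by
  obtain ⟨ψ, hψ⟩ := DefH.relativize h hP
  let t : Option (C ⊕ ℕ) → (ℕ → V) → V
    | none => fun _ => Hs
    | some (Sum.inl c) => fun _ => (W c).1
    | some (Sum.inr 0) => fun w => w 0
    | some (Sum.inr (i + 1)) => fun _ => (v i).1
  have ht : ∀ b, Tm (A := V) (G := PUnit.{u + 1}) (fun _ a => a) (fun _ => t b) := by
    rintro (_ | c | _ | i)
    · exact Tm.par (pv := fun _ a => a) Hs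
    · exact Tm.par (pv := fun _ a => a) (W c).1
    · exact Tm.var 0
    · exact Tm.par (pv := fun _ a => a) (v i).1
  have hd := DefV.subst ψ t ht
  have hd' : DefV fun w : ℕ → V => ψ.Realize fun b => t b (fun _ => w 0) := by
    convert hd using 4 with w
    rename_i b
    rcases b with _ | c | _ | i <;> rfl
  obtain ⟨X, hX⟩ := h.zf.sep (fun x => ψ.Realize fun b => t b fun _ => x) Hs
  refine ⟨⟨X, fun x hx => (h.mem_iff x).1 ((hX x).1 hx).1⟩, fun x => ?_⟩
  refine (hX x.1).trans ?_
  rw [and_iff_right ((h.mem_iff _).2 x.2)]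
  refine Iff.trans (iff_of_eq (congrArg _ ?_)) (hψ (fun c => (W c).1) (cons x v))
  funext b
  rcases b with _ | c | _ | i <;> rfl

/-- Foundation for classes. -/
theorem induct {C : Type} (P : (C → Set (HSet lam)) → (ℕ → HSet lam) → Prop) [hP : DefH P]
    (W : C → HClass lam) (v : ℕ → HSet lam)
    (ih : ∀ x : HSet lam, (∀ y : HSet lam, y ∈ x → P (fun c => (W c).carrier) (cons y v)) →
      P (fun c => (W c).carrier) (cons x v)) (x : HSet lam) :
    P (fun c => (W c).carrier) (cons x v) := by
  obtain ⟨X, hX⟩ := h.exists_class (fun W w => ¬ P W w) W v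
  by_contra hx
  obtain ⟨y, hy, hmin⟩ := h.zf.foundation X.1 ⟨x.1, (hX x).2 hx⟩
  refine (hX ⟨y, X.2 y hy⟩).1 hy (ih _ fun z hz => ?_)
  by_contra hPz
  exact hmin z.1 hz ((hX z).2 hPz)

/-- A monotone definable operator on classes has a fixed point. -/
theorem exists_fixedPoint (P : (Unit → Set (HSet lam)) → (ℕ → HSet lam) → Prop) [hP : DefH P]
    (v : ℕ → HSet lam)
    (mono : ∀ (S T : Set (HSet lam)) (w : ℕ → HSet lam), S ⊆ T → P (fun _ => S) w →
      P (fun _ => T) w) :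
    ∃ Z : HClass lam, ∀ x : HSet lam, x ∈ Z.carrier ↔ P (fun _ => Z.carrier) (cons x v) := by
  obtain ⟨ψ, hψ⟩ := DefH.relativize h hP
  let t : Option (Unit ⊕ ℕ) → (ℕ → V) → V
    | none => fun _ => Hs
    | some (Sum.inl _) => fun w => w 1
    | some (Sum.inr 0) => fun w => w 0
    | some (Sum.inr (i + 1)) => fun _ => (v i).1
  have ht : ∀ b, Tm (A := V) (G := PUnit.{u + 1}) (fun _ a => a) (fun _ => t b) := by
    rintro (_ | c | _ | i)
    · exact Tm.par (pv := fun _ a => a) Hs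
    · exact Tm.var 1
    · exact Tm.var 0
    · exact Tm.par (pv := fun _ a => a) (v i).1
  have hd := DefV.subst ψ t ht
  have hval : ∀ (C : V) (x : HSet lam), (ψ.Realize fun b => t b (cons x.1 (cons C fun _ => C))) ↔
      P (fun _ => {x | x.1 ∈ C}) (cons x v) := by
    intro C x
    refine Iff.trans (iff_of_eq (congrArg _ ?_)) (hψ (fun _ => C) (cons x v))
    funext b
    rcases b with _ | c | _ | i <;> rfl
  let R : V → V → Prop := fun x C => ψ.Realize fun b => t b (cons x (cons C fun _ => C))
  have hR : DefV fun w : ℕ → V => R (w 0) (w 1) := by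
    convert hd using 4 with w
    rename_i b
    rcases b with _ | c | _ | i <;> rfl
  -- Knaster–Tarski: `X` is the intersection of all subsets of `Hs` closed under the operator.
  obtain ⟨X, hX⟩ := h.zf.sep (fun x => ∀ C : V, (∀ y, y ∈ C → y ∈ Hs) →
    (∀ y, y ∈ Hs → R y C → y ∈ C) → x ∈ C) Hs
  have hXH : ∀ x, x ∈ X → x ∈ Hs := fun x hx => ((hX x).1 hx).1
  have : DefV fun w : ℕ → V => R (w 0) X := Ex.comp₂ _ (fun _ _ => X) fun _ => R
  -- `Y` is the operator applied to `X`. It is contained in `X`, hence closed by monotonicity, hence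
  -- contains `X`.
  obtain ⟨Y, hY⟩ := h.zf.sep (fun x => R x X) Hs
  have hsub : ∀ x : HSet lam, P (fun _ => {x | x.1 ∈ X}) (cons x v) → x.1 ∈ X := by
    intro x hx
    refine (hX _).2 ⟨(h.mem_iff _).2 x.2, fun C hC hcl => hcl _ ((h.mem_iff _).2 x.2) ?_⟩
    refine (hval C x).2 (mono _ _ _ (fun y hy => ?_) hx)
    exact ((hX _).1 hy).2 C hC hcl
  refine ⟨⟨X, fun x hx => (h.mem_iff x).1 (hXH x hx)⟩, fun x => ⟨fun hx => ?_, hsub x⟩⟩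
  have hYX : ∀ y, y ∈ Y → y ∈ X := fun y hy =>
    hsub ⟨y, (h.mem_iff y).1 ((hY y).1 hy).1⟩ ((hval X _).1 ((hY y).1 hy).2)
  have : x.1 ∈ Y := ((hX _).1 hx).2 Y (fun y hy => ((hY y).1 hy).1) fun y hy hR => by
    refine (hY y).2 ⟨hy, (hval X ⟨y, (h.mem_iff y).1 hy⟩).2 ?_⟩
    exact mono _ _ _ (fun z hz => hYX _ hz) ((hval Y ⟨y, (h.mem_iff y).1 hy⟩).1 hR)
  exact (hval X x).1 ((hY _).1 this).2

end Ctx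

end SetAction

/-! ### Closure of H, absoluteness between H and V, and usable forms of elementarity. -/

namespace SetAction

universe u v

set_option synthInstance.maxSize 100000
set_option synthInstance.maxHeartbeats 400000

variable {V : Type u} [Membership V V] {lam Hs : V}

namespace Ctx

variable (h : Ctx lam Hs)
include h

/-- The set `Hs ∪ {x}` is transitive, so it contains the transitive closure of {x}. -/
theorem hereditary_of {x : V} (hx : ∀ y : V, y ∈ x → IsHereditary lam y) (hc : CardLE x lam) :
    IsHereditary lam x := by
  intro y hy
  have ht : IsTrans (h.zf.adj.insert Hs x) := by
    intro a ha b hb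
    rw [h.zf.adj.mem_insert] at ha ⊢
    rcases ha with ha | rfl
    · exact Or.inl ((h.mem_iff _).2 (((h.mem_iff _).1 ha).mem hb))
    · exact Or.inl ((h.mem_iff _).2 (hx b hb))
  rcases h.zf.adj.mem_insert.1 (hy _ ht (h.zf.adj.mem_insert.2 (Or.inr rfl))) with hy | rfl
  · exact ((h.mem_iff _).1 hy).cardLE
  · exact hc

theorem hereditary_subset {x y : V} (hy : IsHereditary lam y) (hxy : ∀ z : V, z ∈ x → z ∈ y) :
    IsHereditary lam x :=
  h.hereditary_of (fun z hz => hy.mem (hxy z hz)) (IsModelZF.cardLE_subset hy.cardLE hxy)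

theorem hereditary_empty : IsHereditary lam h.zf.adj.empty :=
  h.hereditary_of (fun y hy => absurd hy (h.zf.adj.notMem_empty y))
    (h.zf.cardLE_refl_of_subset fun y hy => absurd hy (h.zf.adj.notMem_empty y))

theorem hereditary_insert {s t : V} (hs : IsHereditary lam s) (ht : IsHereditary lam t) :
    IsHereditary lam (h.zf.adj.insert s t) := by
  refine h.hereditary_of (fun y hy => ?_) (h.zf.cardLE_insert h.card hs.cardLE t)
  rcases h.zf.adj.mem_insert.1 hy with hy | rfl
  · exact hs.mem hy
  · exact ht

theorem hereditary_lam : IsHereditary lam lam :=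
  h.hereditary_of
    (fun _ hy => h.zf.induct (fun x => IsHereditary lam x) h.card.1.1
      (fun x hx ih => h.hereditary_of ih (h.zf.cardLE_refl_of_subset (h.card.1.1 x hx))) hy)
    (h.zf.cardLE_refl_of_subset fun _ hx => hx)

/-- `lam` as an element of `H(lam⁺)`. -/
def lamH : HSet lam := ⟨lam, h.hereditary_lam⟩

omit h in
theorem mem_coe {x y : HSet lam} : x ∈ y ↔ x.1 ∈ y.1 := Iff.rfl

omit h in
theorem coe_inj {x y : HSet lam} : x.1 = y.1 ↔ x = y := Subtype.ext_iff.symm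

theorem hset_ext {x y : HSet lam} (e : ∀ z : HSet lam, z ∈ x ↔ z ∈ y) : x = y :=
  Subtype.ext (h.zf.ext _ _ fun z =>
    ⟨fun hz => (e ⟨z, x.2.mem hz⟩).1 hz, fun hz => (e ⟨z, y.2.mem hz⟩).2 hz⟩)

theorem hadj : Adj (HSet lam) where
  ext _ _ := h.hset_ext
  exists_empty := ⟨⟨_, h.hereditary_empty⟩, fun z => h.zf.adj.notMem_empty z.1⟩
  exists_insert s t := ⟨⟨_, h.hereditary_insert s.2 t.2⟩, fun _ =>
    h.zf.adj.mem_insert.trans (or_congr Iff.rfl coe_inj)⟩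

theorem coe_eq_of {x : HSet lam} {y : V} (hy : ∀ z : V, z ∈ y → IsHereditary lam z)
    (e : ∀ z : HSet lam, z ∈ x ↔ z.1 ∈ y) : x.1 = y :=
  h.zf.ext _ _ fun z => ⟨fun hz => (e ⟨z, x.2.mem hz⟩).1 hz, fun hz => (e ⟨z, hy z hz⟩).2 hz⟩

theorem coe_insert (s t : HSet lam) : (h.hadj.insert s t).1 = h.zf.adj.insert s.1 t.1 := by
  refine h.coe_eq_of (fun z hz => (h.hereditary_insert s.2 t.2).mem hz) fun z => ?_
  rw [h.hadj.mem_insert, h.zf.adj.mem_insert, mem_coe, coe_inj]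

theorem coe_empty : h.hadj.empty.1 = h.zf.adj.empty :=
  h.zf.adj.eq_empty fun z hz => h.hadj.notMem_empty ⟨z, h.hadj.empty.2.mem hz⟩ hz

theorem coe_upair (x y : HSet lam) : (h.hadj.upair x y).1 = h.zf.adj.upair x.1 y.1 := by
  simp only [Adj.upair, h.coe_insert, h.coe_empty]

theorem coe_op (x y : HSet lam) : (h.hadj.op x y).1 = h.zf.adj.op x.1 y.1 := by
  simp only [Adj.op, h.coe_upair]

theorem isOPair_coe {q x y : HSet lam} : IsOPair q.1 x.1 y.1 ↔ IsOPair q x y := by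
  rw [h.zf.adj.isOPair_iff, h.hadj.isOPair_iff, ← h.coe_op, coe_inj]

theorem pairMem_coe {f x y : HSet lam} : PairMem f.1 x.1 y.1 ↔ PairMem f x y := by
  rw [h.zf.adj.pairMem_iff, h.hadj.pairMem_iff, ← h.coe_op]
  rfl

omit h in
theorem isTrans_coe {x : HSet lam} : IsTrans x.1 ↔ IsTrans x :=
  ⟨fun H y hy z hz => H y.1 hy z.1 hz, fun H y hy z hz =>
    H ⟨y, x.2.mem hy⟩ hy ⟨z, (x.2.mem hy).mem hz⟩ hz⟩

omit h in
theorem isOrd_coe {x : HSet lam} : IsOrd x.1 ↔ IsOrd x :=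
  and_congr isTrans_coe ⟨fun H y hy => isTrans_coe.1 (H y.1 hy), fun H y hy =>
    (isTrans_coe (x := ⟨y, x.2.mem hy⟩)).2 (H _ hy)⟩

/-- A definable set of pairs with at most one pair for each element of a set in `H(lam⁺)`. -/
theorem exists_graph (R : V → V → Prop) [hR : DefV fun w : ℕ → V => R (w 0) (w 1)]
    {a : V} (ha : CardLE a lam) (haH : ∀ x : V, x ∈ a → IsHereditary lam x)
    (fn : ∀ x y y' : V, x ∈ a → IsHereditary lam y → IsHereditary lam y' → R x y → R x y' → y = y') :
    ∃ f : HSet lam, ∀ q : V, q ∈ f.1 ↔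
      ∃ x y : V, x ∈ a ∧ IsHereditary lam y ∧ R x y ∧ IsOPair q x y := by
  obtain ⟨f, hf⟩ := h.zf.exists_rel R a Hs
  simp only [h.mem_iff] at hf
  refine ⟨⟨f, h.hereditary_of (fun q hq => ?_) (h.zf.cardLE_trans ?_ ha)⟩, hf⟩
  · obtain ⟨x, y, hx, hy, -, hq⟩ := (hf q).1 hq
    rw [h.zf.adj.isOPair_iff.1 hq, ← h.coe_op ⟨x, haH x hx⟩ ⟨y, hy⟩]
    exact (h.hadj.op _ _).2
  · refine h.zf.cardLE_of (fun q x => ∃ y, IsOPair q x y) ?_ ?_ ?_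
    · intro q hq
      obtain ⟨x, y, hx, -, -, hq⟩ := (hf q).1 hq
      exact ⟨x, hx, y, hq⟩
    · rintro q x x' - - - ⟨y, hq⟩ ⟨y', hq'⟩
      rw [h.zf.adj.isOPair_iff] at hq hq'
      exact (h.zf.adj.op_inj.1 (hq.symm.trans hq')).1
    · rintro q q' x hq hq' hx ⟨y, e⟩ ⟨y', e'⟩
      obtain ⟨x₁, y₁, -, hy₁, hR₁, e₁⟩ := (hf q).1 hq
      obtain ⟨x₂, y₂, -, hy₂, hR₂, e₂⟩ := (hf q').1 hq'
      rw [h.zf.adj.isOPair_iff] at e e' e₁ e₂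
      obtain ⟨rfl, rfl⟩ := h.zf.adj.op_inj.1 (e.symm.trans e₁)
      obtain ⟨rfl, rfl⟩ := h.zf.adj.op_inj.1 (e'.symm.trans e₂)
      rw [e, e', fn x y y' hx hy₁ hy₂ hR₁ hR₂]

/-- An injection in V, cut down to pairs in a × b, consists of at most λ pairs from H and so belongs
to H. -/
theorem cardLE_coe {a b : HSet lam} : CardLE a.1 b.1 ↔ CardLE a b := by
  constructor
  · rintro ⟨f, f₁, f₂⟩
    obtain ⟨g, hg⟩ := h.exists_graph (fun x y => y ∈ b.1 ∧ PairMem f x y) a.2.cardLE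
      (fun x hx => a.2.mem hx) (fun x y y' hx _ _ hy hy' => (f₁ x hx).unique hy hy')
    have key : ∀ x y : HSet lam, PairMem g x y ↔ x ∈ a ∧ y ∈ b ∧ PairMem f x.1 y.1 := by
      intro x y
      rw [← h.pairMem_coe, h.zf.adj.pairMem_iff, hg]
      simp only [h.zf.adj.isOPair_iff, h.zf.adj.op_inj]
      constructor
      · rintro ⟨x', y', hx, -, ⟨hy, hf⟩, rfl, rfl⟩
        exact ⟨hx, hy, hf⟩
      · rintro ⟨hx, hy, hf⟩
        exact ⟨x.1, y.1, hx, y.2, ⟨hy, hf⟩, rfl, rfl⟩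
    refine ⟨g, fun x hx => ?_, fun x x' y hx hx' hy hg hg' => ?_⟩
    · obtain ⟨y, ⟨hy, hxy⟩, -⟩ := f₁ x.1 hx
      refine ⟨⟨y, b.2.mem hy⟩, ⟨hy, (key _ _).2 ⟨hx, hy, hxy⟩⟩, fun y' ⟨hy', hxy'⟩ => ?_⟩
      exact Subtype.ext ((f₁ x.1 hx).unique ⟨hy', ((key _ _).1 hxy').2.2⟩ ⟨hy, hxy⟩)
    · exact Subtype.ext (f₂ _ _ _ hx hx' hy ((key _ _).1 hg).2.2 ((key _ _).1 hg').2.2)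
  · rintro ⟨f, f₁, f₂⟩
    refine ⟨f.1, fun x hx => ?_, fun x x' y hx hx' hy hxy hxy' => ?_⟩
    · obtain ⟨y, ⟨hy, hxy⟩, hu⟩ := f₁ ⟨x, a.2.mem hx⟩ hx
      refine ⟨y.1, ⟨hy, h.pairMem_coe.2 hxy⟩, fun y' ⟨hy', hxy'⟩ => ?_⟩
      exact congrArg Subtype.val (hu ⟨y', b.2.mem hy'⟩
        ⟨hy', (h.pairMem_coe (f := f) (x := ⟨x, a.2.mem hx⟩) (y := ⟨y', b.2.mem hy'⟩)).1 hxy'⟩)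
    · have h₁ := (h.pairMem_coe (f := f) (x := ⟨x, a.2.mem hx⟩) (y := ⟨y, b.2.mem hy⟩)).1 hxy
      have h₂ := (h.pairMem_coe (f := f) (x := ⟨x', a.2.mem hx'⟩) (y := ⟨y, b.2.mem hy⟩)).1 hxy'
      exact congrArg Subtype.val (f₂ _ _ _ hx hx' hy h₁ h₂)

end Ctx

section Elementarity

variable {j : HSet lam → HSet lam} {jstar : HClass lam → HClass lam}
  (hel : IsSigma11Elementary j jstar)
include hel

open FirstOrder FirstOrder.Language

/-- The hypothesis speaks of formulas in `Fin n` variables, while `DefH` uses ℕ many. A formula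
mentions only finitely many of them, so the free variables are renumbered. -/
theorem IsSigma11Elementary.exists_iff {c m : ℕ}
    (P : (Fin c ⊕ Fin m → Set (HSet lam)) → (ℕ → HSet lam) → Prop) [hP : DefH P]
    (X : Fin c → HClass lam) (a : ℕ → HSet lam) :
    (∃ Y : Fin m → HClass lam,
      P (Sum.elim (fun i => (X i).carrier) fun i => (Y i).carrier) a) ↔
    (∃ Y : Fin m → HClass lam,
      P (Sum.elim (fun i => (jstar (X i)).carrier) fun i => (Y i).carrier) (fun i => j (a i))) := by
  classical
  obtain ⟨φ, hφ⟩ := hP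
  let e := φ.freeVarFinset.equivFin
  let ev : (ℕ → HSet lam) → PEmpty.{u + 1} ⊕ ℕ → HSet lam := fun a => Sum.elim (fun b => b.elim) a
  have key := hel _ c m (BoundedFormula.restrictFreeVar φ e) (fun i => ev a (e.symm i).1) X
  have hr : ∀ (W : Fin c ⊕ Fin m → Set (HSet lam)) (a : ℕ → HSet lam),
      Sat W (BoundedFormula.restrictFreeVar φ e) (fun i => ev a (e.symm i).1) ↔ P W a := by
    intro W a
    rw [← hφ]
    let _ := clsStructure W
    exact BoundedFormula.realize_restrictFreeVar _ fun x => by simp [ev]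
  have hj : (j ∘ fun i => ev a (e.symm i).1) = fun i => ev (fun i => j (a i)) (e.symm i).1 := by
    funext i
    simp only [Function.comp_apply, ev]
    rcases (e.symm i).1 with b | k
    · exact b.elim
    · rfl
  rw [hj] at key
  simpa only [hr] using key

theorem IsSigma11Elementary.iff {c : ℕ}
    (P : (Fin c → Set (HSet lam)) → (ℕ → HSet lam) → Prop)
    [DefH fun (W : Fin c ⊕ Fin 0 → Set (HSet lam)) w => P (fun i => W (Sum.inl i)) w]
    (X : Fin c → HClass lam) (a : ℕ → HSet lam) :
    P (fun i => (X i).carrier) a ↔ P (fun i => (jstar (X i)).carrier) (fun i => j (a i)) := by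
  have := hel.exists_iff
    (fun (W : Fin c ⊕ Fin 0 → Set (HSet lam)) w => P (fun i => W (Sum.inl i)) w) X a
  simpa using this

end Elementarity

end SetAction

/-! ### Consequences of elementarity: the critical point, fixed sets, and `jstar` on small classes.
-/

namespace SetAction

universe u v

set_option synthInstance.maxSize 100000
set_option synthInstance.maxHeartbeats 400000

variable {V : Type u} [Membership V V] {lam Hs : V}

/-- `⟨x, y⟩ ∈ S` for a class `S`. -/
def Fn {D : Type u} [Membership D D] (S : Set D) (x y : D) : Prop := ∃ q : D, q ∈ S ∧ IsOPair q x y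

instance Ex.fn {C : Type} {D : Type u} [Membership D D] {A G : Type v} {cv : G → C → Set D}
    {pv : G → A → D} (X : C) (f₁ f₂ : G → (ℕ → D) → D) [Tm pv f₁] [Tm pv f₂] :
    Ex cv pv (fun g w => Fn (cv g X) (f₁ g w) (f₂ g w)) := by
  have : Ex cv pv (fun g w => Fn (cv g X) (w 0) (w 1)) := by
    unfold Fn
    infer_instance
  exact Ex.comp₂ f₁ f₂ fun g => Fn (cv g X)

theorem Adj.fn_iff {D : Type u} [Membership D D] (h : Adj D) {S : Set D} {x y : D} :
    Fn S x y ↔ h.op x y ∈ S := by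
  simp [Fn, h.isOPair_iff]

namespace Ctx

variable (h : Ctx lam Hs)
include h

theorem fn_coe {X : HClass lam} {x y : HSet lam} :
    Fn X.carrier x y ↔ PairMem X.1 x.1 y.1 := by
  rw [h.hadj.fn_iff, h.zf.adj.pairMem_iff, ← h.coe_op]
  rfl

theorem exists_graph_class {j : HSet lam → HSet lam} (hj : IsInternal j) :
    ∃ J : HClass lam, (∀ x y : HSet lam, Fn J.carrier x y ↔ y = j x) ∧
      ∀ q : HSet lam, q ∈ J.carrier → ∃ x y : HSet lam, IsOPair q x y := by
  obtain ⟨g, hg⟩ := hj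
  simp only [h.zf.adj.isOPair_iff, ← h.coe_op] at hg
  refine ⟨⟨g, fun q hq => ?_⟩, fun x y => ?_, fun q hq => ?_⟩
  · obtain ⟨x, rfl⟩ := (hg q).1 hq
    exact (h.hadj.op _ _).2
  · rw [h.hadj.fn_iff]
    refine (hg _).trans ?_
    simp only [coe_inj, h.hadj.op_inj]
    constructor
    · rintro ⟨x', rfl, rfl⟩
      rfl
    · rintro rfl
      exact ⟨x, rfl, rfl⟩
  · obtain ⟨x, hx⟩ := (hg q.1).1 hq
    exact ⟨x, j x, h.hadj.isOPair_iff.2 (coe_inj.1 hx)⟩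

theorem trichotomy {x y : HSet lam} (hx : IsOrd x) (hy : IsOrd y) : x ∈ y ∨ x = y ∨ y ∈ x := by
  rw [← coe_inj]
  exact h.zf.trichotomy (isOrd_coe.2 hx) (isOrd_coe.2 hy)

theorem isOrd_lamH : IsOrd h.lamH := isOrd_coe.1 h.card.1

/-- All ordinals below λ⁺ lie in H, so an injection of `p` into λ⁺ is a class of H to which `jstar`
can be applied. -/
theorem exists_index {p : HClass lam} (hp : ∃ l : V, IsSuccCardinal lam l ∧ CardLE p.1 l) :
    ∃ F : HClass lam, (∀ y : HSet lam, y ∈ p.carrier → ∃ b : HSet lam, IsOrd b ∧ Fn F.carrier y b) ∧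
      (∀ y b b' : HSet lam, Fn F.carrier y b → Fn F.carrier y b' → b = b') ∧
      (∀ y y' b : HSet lam, Fn F.carrier y b → Fn F.carrier y' b → y = y') ∧
      ∀ q : HSet lam, q ∈ F.carrier →
        ∃ y b : HSet lam, y ∈ p.carrier ∧ IsOrd b ∧ IsOPair q y b := by
  obtain ⟨l, hl, f, f₁, f₂⟩ := hp
  have hlH : ∀ b : V, b ∈ l → IsHereditary lam b := fun b hb =>
    h.zf.induct (fun x => IsHereditary lam x) hl.1.1
      (fun x hx ih => h.hereditary_of ih (hl.2.2 x hx)) hb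
  obtain ⟨F, hF⟩ := h.zf.exists_rel (fun x y => PairMem f x y) p.1 l
  have hFH : ∀ q : V, q ∈ F → ∃ y b : HSet lam, y ∈ p.carrier ∧ b.1 ∈ l ∧ q = (h.hadj.op y b).1 := by
    intro q hq
    obtain ⟨y, b, hy, hb, -, e⟩ := (hF q).1 hq
    refine ⟨⟨y, p.2 y hy⟩, ⟨b, hlH b hb⟩, hy, hb, ?_⟩
    exact (h.zf.adj.isOPair_iff.1 e).trans (h.coe_op ⟨y, p.2 y hy⟩ ⟨b, hlH b hb⟩).symm
  have key : ∀ y b : V, PairMem F y b ↔ y ∈ p.1 ∧ b ∈ l ∧ PairMem f y b := by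
    intro y b
    rw [h.zf.adj.pairMem_iff, hF]
    simp only [h.zf.adj.isOPair_iff, h.zf.adj.op_inj]
    constructor
    · rintro ⟨y', b', hy, hb, hf, rfl, rfl⟩
      exact ⟨hy, hb, hf⟩
    · rintro ⟨hy, hb, hf⟩
      exact ⟨y, b, hy, hb, hf, rfl, rfl⟩
  obtain ⟨X, hX⟩ : ∃ X : HClass lam, X.1 = F := by
    refine ⟨⟨F, fun q hq => ?_⟩, rfl⟩
    obtain ⟨y, b, -, -, rfl⟩ := hFH q hq
    exact (h.hadj.op _ _).2
  have hfn : ∀ y b : HSet lam,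
      Fn X.carrier y b ↔ y.1 ∈ p.1 ∧ b.1 ∈ l ∧ PairMem f y.1 b.1 := by
    intro y b
    rw [h.fn_coe, hX, key]
  refine ⟨X, fun y hy => ?_, fun y b b' hb hb' => ?_, fun y y' b hy hy' => ?_, fun q hq => ?_⟩
  · obtain ⟨b, ⟨hb, hyb⟩, -⟩ := f₁ y.1 hy
    exact ⟨⟨b, hlH b hb⟩, isOrd_coe.1 (hl.1.mem hb), (hfn _ _).2 ⟨hy, hb, hyb⟩⟩
  · rw [hfn] at hb hb'
    exact coe_inj.1 ((f₁ y.1 hb.1).unique hb.2 hb'.2)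
  · rw [hfn] at hy hy'
    exact coe_inj.1 (f₂ _ _ _ hy.1 hy'.1 hy.2.1 hy.2.2 hy'.2.2)
  · obtain ⟨y, b, hy, hb, e⟩ := hFH q.1 (hX ▸ hq)
    exact ⟨y, b, hy, isOrd_coe.1 (hl.1.mem hb), h.hadj.isOPair_iff.2 (coe_inj.1 e)⟩

/-- If V_λ is in H, every earlier stage is a subset of it and so is in H; the sequence of stages up
to λ then has λ many entries and is in H too. -/
theorem isRankStage_coe {v : HSet lam} (hv : IsRankStage lam v.1) : IsRankStage h.lamH v := by
  obtain ⟨s, s₁, s₂, s₃⟩ := hv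
  have hmem : ∀ a : V, a ∈ h.zf.adj.insert lam lam ↔ a ∈ lam ∨ a = lam := fun a =>
    h.zf.adj.mem_insert
  obtain ⟨f, hf⟩ := h.exists_graph (fun x y => PairMem s x y) (a := h.zf.adj.insert lam lam)
    (h.zf.cardLE_insert h.card h.hereditary_lam.cardLE lam)
    (fun x hx => (h.hereditary_insert h.hereditary_lam h.hereditary_lam).mem hx)
    (fun x y y' hx _ _ hy hy' => (s₁ x ((hmem x).1 hx)).unique hy hy')
  have key : ∀ x y : HSet lam, PairMem f x y ↔ (x ∈ h.lamH ∨ x = h.lamH) ∧ PairMem s x.1 y.1 := by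
    intro x y
    rw [← h.pairMem_coe, h.zf.adj.pairMem_iff, hf]
    simp only [h.zf.adj.isOPair_iff, h.zf.adj.op_inj, hmem]
    rw [← coe_inj (y := h.lamH)]
    constructor
    · rintro ⟨x', y', hx, -, hs, rfl, rfl⟩
      exact ⟨hx, hs⟩
    · rintro ⟨hx, hs⟩
      exact ⟨x.1, y.1, hx, y.2, hs, rfl, rfl⟩
  have hcase : ∀ {a : HSet lam}, a ∈ h.lamH ∨ a = h.lamH → a.1 ∈ lam ∨ a.1 = lam := fun ha =>
    ha.imp id coe_inj.2
  have hin : ∀ a y : V, a ∈ lam ∨ a = lam → PairMem s a y → IsHereditary lam y := by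
    intro a y ha hy
    refine h.hereditary_subset v.2 fun z hz => ?_
    obtain ⟨b, w, hb, hw, hzw⟩ := (s₂ a y ha hy z).1 hz
    refine (s₂ lam v.1 (Or.inr rfl) s₃ z).2 ⟨b, w, ?_, hw, hzw⟩
    rcases ha with ha | rfl
    · exact h.card.1.1 a ha b hb
    · exact hb
  refine ⟨f, fun a ha => ?_, fun a y ha hy z => ?_, (key _ _).2 ⟨Or.inr rfl, s₃⟩⟩
  · obtain ⟨y, hy, hu⟩ := s₁ a.1 (hcase ha)
    exact ⟨⟨y, hin _ y (hcase ha) hy⟩, (key _ _).2 ⟨ha, hy⟩,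
      fun y' hy' => coe_inj.1 (hu y'.1 ((key _ _).1 hy').2)⟩
  · refine (s₂ a.1 y.1 (hcase ha) ((key _ _).1 hy).2 z.1).trans ⟨?_, ?_⟩
    · rintro ⟨b, w, hb, hw, hzw⟩
      have hb' : b ∈ lam := by
        rcases hcase ha with ha | ha
        · exact h.card.1.1 a.1 ha b hb
        · exact ha ▸ hb
      have hbH := h.hereditary_lam.mem hb'
      refine ⟨⟨b, hbH⟩, ⟨w, hin b w (Or.inl hb') hw⟩, hb, (key _ _).2 ⟨Or.inl hb', hw⟩, ?_⟩
      exact fun t ht => hzw t.1 ht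
    · rintro ⟨b, w, hb, hw, hzw⟩
      exact ⟨b.1, w.1, hb, ((key _ _).1 hw).2, fun t ht => hzw ⟨t, z.2.mem ht⟩ ht⟩

theorem isRankStage_unique {v v' : HSet lam} (hv : IsRankStage h.lamH v)
    (hv' : IsRankStage h.lamH v') : v = v' := by
  obtain ⟨s, s₁, s₂, s₃⟩ := hv
  obtain ⟨t, t₁, t₂, t₃⟩ := hv'
  have key := h.induct (fun (_ : Empty → Set (HSet lam)) w => (w 0 ∈ w 1 ∨ w 0 = w 1) →
    ∀ y y', PairMem (w 2) (w 0) y → PairMem (w 3) (w 0) y' → y = y') (fun X => X.elim)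
    (cons h.lamH (cons s (cons t fun _ => t))) (fun x ih hx y y' hy hy' => ?_) h.lamH (Or.inr rfl)
  · exact key v v' s₃ t₃
  · have htr : ∀ b : HSet lam, b ∈ x → b ∈ h.lamH := by
      intro b hb
      rcases hx with hx | hx
      · exact h.isOrd_lamH.1 x hx b hb
      · exact (show x = h.lamH from hx) ▸ hb
    refine h.hset_ext fun z => (s₂ x y hx hy z).trans (Iff.trans ?_ (t₂ x y' hx hy' z).symm)
    constructor
    · rintro ⟨b, w, hb, hw, hzw⟩
      obtain ⟨w', hw', -⟩ := t₁ b (Or.inl (htr b hb))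
      exact ⟨b, w', hb, hw', ih b hb (Or.inl (htr b hb)) w w' hw hw' ▸ hzw⟩
    · rintro ⟨b, w', hb, hw', hzw⟩
      obtain ⟨w, hw, -⟩ := s₁ b (Or.inl (htr b hb))
      exact ⟨b, w, hb, hw, ih b hb (Or.inl (htr b hb)) w w' hw hw' ▸ hzw⟩

end Ctx

section Embedding

variable {j : HSet lam → HSet lam} {jstar : HClass lam → HClass lam} (h : Ctx lam Hs)
  (hel : IsSigma11Elementary j jstar)

namespace IsSigma11Elementary

include hel

theorem mem_iff {x y : HSet lam} : x ∈ y ↔ j x ∈ j y :=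
  hel.iff (c := 0) (fun _ w => w 0 ∈ w 1) Fin.elim0 (cons x fun _ => y)

theorem eq_iff {x y : HSet lam} : x = y ↔ j x = j y :=
  hel.iff (c := 0) (fun _ w => w 0 = w 1) Fin.elim0 (cons x fun _ => y)

theorem isOrd_iff {x : HSet lam} : IsOrd x ↔ IsOrd (j x) :=
  hel.iff (c := 0) (fun _ w => IsOrd (w 0)) Fin.elim0 (fun _ => x)

include h

theorem map_insert (s t : HSet lam) : j (h.hadj.insert s t) = h.hadj.insert (j s) (j t) :=
  h.hadj.eq_insert ((hel.iff (c := 0) (fun _ w => ∀ z, z ∈ w 2 ↔ z ∈ w 0 ∨ z = w 1) Fin.elim0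
    (cons s (cons t fun _ => h.hadj.insert s t))).1 fun _ => h.hadj.mem_insert)

theorem map_empty : j h.hadj.empty = h.hadj.empty :=
  h.hadj.eq_empty ((hel.iff (c := 0) (fun _ w => ∀ z, z ∉ w 0) Fin.elim0
    (fun _ => h.hadj.empty)).1 h.hadj.notMem_empty)

variable (hj : IsInternal j)
include hj

/-- If j(x) ∈ x, then j(j(x)) ∈ j(x) is a counterexample at a smaller ordinal. The graph `J` makes
the induction hypothesis a definable property of classes. -/
theorem not_map_mem {x : HSet lam} (hx : IsOrd x) : j x ∉ x := by
  obtain ⟨J, hJ, -⟩ := h.exists_graph_class hj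
  have key := h.induct (fun (W : Unit → Set (HSet lam)) w => IsOrd (w 0) →
    ∀ y, Fn (W ()) (w 0) y → y ∉ w 0) (fun _ => J) (fun _ => x) (fun x ih hx y hy hyx => ?_) x hx
  · exact key _ ((hJ _ _).2 rfl)
  · obtain rfl := (hJ _ _).1 hy
    exact ih _ hyx (hel.isOrd_iff.1 hx) _ ((hJ _ _).2 rfl) (hel.mem_iff.1 hyx)

/-- By ∈-induction: let f inject x into λ. Each y ∈ j(x) has an index a = j(f)(y) below j(λ) = λ,
which is fixed, so a = f(y₀) for some y₀ ∈ x by elementarity. Injectivity of j(f) gives y = j(y₀) =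
y₀. Thus j(x) gains no new elements. -/
theorem eq_id (hord : ∀ x : HSet lam, IsOrd x → j x = x) : j = id := by
  obtain ⟨J, hJ, -⟩ := h.exists_graph_class hj
  funext x
  have hlam := hord _ h.isOrd_lamH
  refine ((hJ _ _).1 (h.induct (fun (W : Unit → Set (HSet lam)) w => Fn (W ()) (w 0) (w 0))
    (fun _ => J) (fun _ => x) (fun x ih => (hJ _ _).2 ?_) x)).symm
  have ih' : ∀ y : HSet lam, y ∈ x → j y = y := fun y hy => ((hJ _ _).1 (ih y hy)).symm
  obtain ⟨f, f₁, f₂⟩ := (h.cardLE_coe (a := x) (b := h.lamH)).1 x.2.cardLE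
  have e₁ := (hel.iff (c := 0) (fun _ w => ∀ y, y ∈ w 0 → ∃ a, a ∈ w 1 ∧ PairMem (w 2) y a) Fin.elim0
    (cons x (cons h.lamH fun _ => f))).1 fun y hy => (f₁ y hy).exists
  have e₂ := (hel.iff (c := 0) (fun _ w => ∀ y y' a, y ∈ w 0 → y' ∈ w 0 → a ∈ w 1 →
    PairMem (w 2) y a → PairMem (w 2) y' a → y = y') Fin.elim0
    (cons x (cons h.lamH fun _ => f))).1 f₂
  refine h.hset_ext fun y => ⟨fun hy => ?_, fun hy => ?_⟩
  · exact ih' y hy ▸ hel.mem_iff.1 hy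
  obtain ⟨a, ha, hya⟩ := e₁ y hy
  have ha' : a ∈ h.lamH := hlam ▸ ha
  have hja := hord a (h.isOrd_lamH.mem ha')
  obtain ⟨y₀, hy₀, hf⟩ := (hel.iff (c := 0) (fun _ w => ∃ y, y ∈ w 0 ∧ PairMem (w 1) y (w 2)) Fin.elim0
    (cons x (cons f fun _ => a))).2 ⟨y, hy, show PairMem (j f) y (j a) from hja.symm ▸ hya⟩
  have hf' := (hel.iff (c := 0) (fun _ w => PairMem (w 0) (w 1) (w 2)) Fin.elim0
    (cons f (cons y₀ fun _ => a))).1 hf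
  have : y = j y₀ := e₂ y (j y₀) a hy (hel.mem_iff.1 hy₀) ha hya (hja ▸ hf')
  rw [this, ih' y₀ hy₀]
  exact hy₀

theorem exists_isCrit (hne : j ≠ id) : ∃ k : HSet lam, IsCrit j k := by
  by_contra hno
  refine hne (eq_id h hel hj fun x hx => ?_)
  obtain ⟨J, hJ, -⟩ := h.exists_graph_class hj
  refine ((hJ _ _).1 (h.induct (fun (W : Unit → Set (HSet lam)) w => IsOrd (w 0) →
    Fn (W ()) (w 0) (w 0)) (fun _ => J) (fun _ => x) (fun x ih hx => (hJ _ _).2 ?_) x hx)).symm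
  by_contra hx'
  exact hno ⟨x, Ctx.isOrd_coe.2 hx, fun e => hx' e.symm,
    fun a ha => ((hJ _ _).1 (ih a ha (hx.mem ha))).symm⟩

/-- If λ were an element of j(λ), then by elementarity j(λ) would not inject into λ, contradicting
j(λ) ∈ H. -/
theorem map_lamH : j h.lamH = h.lamH := by
  have hord := hel.isOrd_iff.1 h.isOrd_lamH
  rcases h.trichotomy hord h.isOrd_lamH with e | e | e
  · exact absurd e (not_map_mem h hel hj h.isOrd_lamH)
  · exact e
  · refine absurd (h.cardLE_coe.1 (j h.lamH).2.cardLE) ((hel.iff (c := 0)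
      (fun _ w => ∀ a, a ∈ w 0 → ¬ CardLE (w 0) a) Fin.elim0 (fun _ => h.lamH)).1 ?_ _ e)
    exact fun a ha hc => h.card.2.2.2 a.1 ha (h.cardLE_coe.2 hc)

theorem map_rankStage {v : HSet lam} (hv : IsRankStage lam v.1) : j v = v := by
  have hv' := h.isRankStage_coe hv
  have := (hel.iff (c := 0) (fun _ w => IsRankStage (w 0) (w 1)) Fin.elim0
    (cons h.lamH fun _ => v)).1 hv'
  refine h.isRankStage_unique ?_ hv'
  exact map_lamH h hel hj ▸ this

/-- On small classes, `jstar` is the canonical extension of `j`. -/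
theorem mem_jstar_iff {p : HClass lam} (hp : ∃ l : V, IsSuccCardinal lam l ∧ CardLE p.1 l)
    {y : HSet lam} : y ∈ (jstar p).carrier ↔
      ∃ z : HSet lam, (∀ w : HSet lam, w ∈ z → w ∈ p.carrier) ∧ y ∈ j z := by
  constructor
  swap
  · rintro ⟨z, hz, hy⟩
    exact (hel.iff (c := 1) (fun W w => ∀ t, t ∈ w 0 → t ∈ W 0) (fun _ => p) (fun _ => z)).1 hz y hy
  intro hy
  obtain ⟨F, F₁, F₂, F₃, -⟩ := h.exists_index hp
  obtain ⟨b, hb, hyb⟩ := (hel.iff (c := 2) (fun W _ => ∀ y, y ∈ W 0 → ∃ b, IsOrd b ∧ Fn (W 1) y b)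
    ![p, F] (fun _ => y)).1 F₁ y hy
  -- The index b of y need not be in the range of j. But b ≤ j(b), so b lies in j(b ∪ {b}), and the
  -- piece of p with indices in b ∪ {b} has an image containing y.
  let a := h.hadj.insert b b
  have hba : b ∈ j a := by
    rw [map_insert h hel, h.hadj.mem_insert]
    rcases h.trichotomy hb (hel.isOrd_iff.1 hb) with e | e | e
    · exact Or.inl e
    · exact Or.inr e
    · exact absurd e (not_map_mem h hel hj hb)
  obtain ⟨X, hX⟩ := h.exists_class (fun (W : Fin 2 → Set (HSet lam)) w =>
    w 0 ∈ W 0 ∧ ∃ c, c ∈ w 1 ∧ Fn (W 1) (w 0) c) ![p, F] (fun _ => a)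
  -- The indexing injects this piece into `a`, so the piece is an element of H.
  have hXH : IsHereditary lam X.1 := by
    refine h.hereditary_of X.2 (h.zf.cardLE_trans (h.zf.cardLE_of
      (fun w c => PairMem F.1 w c) (b := a.1) (fun w hw => ?_) (fun w c c' hw hc hc' e e' => ?_)
      (fun w w' c hw hw' hc e e' => ?_)) a.2.cardLE)
    · obtain ⟨-, c, hc, hwc⟩ := (hX ⟨w, X.2 w hw⟩).1 hw
      exact ⟨c.1, hc, h.fn_coe.1 hwc⟩
    · have := F₂ ⟨w, X.2 w hw⟩ ⟨c, a.2.mem hc⟩ ⟨c', a.2.mem hc'⟩ (h.fn_coe.2 e) (h.fn_coe.2 e')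
      exact congrArg Subtype.val this
    · have := F₃ ⟨w, X.2 w hw⟩ ⟨w', X.2 w' hw'⟩ ⟨c, a.2.mem hc⟩ (h.fn_coe.2 e) (h.fn_coe.2 e')
      exact congrArg Subtype.val this
  obtain ⟨z, hz⟩ : ∃ z : HSet lam, z.1 = X.1 := ⟨⟨X.1, hXH⟩, rfl⟩
  have hz' : ∀ t : HSet lam, t ∈ z ↔ t ∈ p.carrier ∧ ∃ c, c ∈ a ∧ Fn F.carrier t c := by
    intro t
    rw [Ctx.mem_coe, hz]
    exact hX t
  refine ⟨z, fun w hw => ((hz' w).1 hw).1, ?_⟩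
  exact ((hel.iff (c := 2) (fun W w => ∀ t, t ∈ w 0 ↔ t ∈ W 0 ∧ ∃ c, c ∈ w 1 ∧ Fn (W 1) t c)
    ![p, F] (cons z fun _ => a)).1 hz' y).2 ⟨hy, b, hba, hyb⟩

end IsSigma11Elementary

end Embedding

end SetAction

/-! ### Bounded formulas, and the size of k⁺(p) for a Δ₀-embedding k. -/

namespace SetAction

universe u v

set_option synthInstance.maxSize 100000
set_option synthInstance.maxHeartbeats 400000

section BoundedFormulas

open FirstOrder FirstOrder.Language

variable {A : Type} {D : Type u} [Membership D D] {n : ℕ}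

/-- `f` reads off one of the variables. -/
class Tm0 (f : (A → D) → (Fin n → D) → D) : Prop where
  out : ∃ t : A ⊕ Fin n, ∀ a xs, Sum.elim a xs t = f a xs

/-- `P` is expressed by a `Δ₀` formula. -/
class D0 (P : (A → D) → (Fin n → D) → Prop) : Prop where
  out : ∃ φ : (setLang Empty).BoundedFormula A n, IsDelta0 φ ∧ ∀ a xs, φ.Realize a xs ↔ P a xs

omit [Membership D D] in
instance Tm0.free (i : A) : Tm0 (fun (a : A → D) (_ : Fin n → D) => a i) := ⟨Sum.inl i, fun _ _ => rfl⟩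

omit [Membership D D] in
instance Tm0.bound (i : Fin n) : Tm0 (fun (_ : A → D) (xs : Fin n → D) => xs i) :=
  ⟨Sum.inr i, fun _ _ => rfl⟩

namespace D0

variable {P Q : (A → D) → (Fin n → D) → Prop}

theorem of_iff (P : (A → D) → (Fin n → D) → Prop) [hP : D0 P] (e : ∀ a xs, P a xs ↔ Q a xs) :
    D0 Q := by
  have : P = Q := by funext a xs; exact propext (e a xs)
  exact this ▸ hP

instance mem (f g : (A → D) → (Fin n → D) → D) [hf : Tm0 f] [hg : Tm0 g] :
    D0 (fun a xs => f a xs ∈ g a xs) := by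
  obtain ⟨s, hs⟩ := hf
  obtain ⟨t, ht⟩ := hg
  refine ⟨BoundedFormula.rel (SetRel.mem : SetRel Empty 2) ![Term.var s, Term.var t],
    IsDelta0.rel _ _, fun a xs => ?_⟩
  rw [← hs, ← ht]
  rfl

instance eq (f g : (A → D) → (Fin n → D) → D) [hf : Tm0 f] [hg : Tm0 g] :
    D0 (fun a xs => f a xs = g a xs) := by
  obtain ⟨s, hs⟩ := hf
  obtain ⟨t, ht⟩ := hg
  refine ⟨BoundedFormula.equal (Term.var s) (Term.var t), IsDelta0.equal _ _, fun a xs => ?_⟩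
  rw [← hs, ← ht]
  rfl

instance falsum : D0 (fun (_ : A → D) (_ : Fin n → D) => False) :=
  ⟨BoundedFormula.falsum, IsDelta0.falsum, fun _ _ => Iff.rfl⟩

instance imp [hP : D0 P] [hQ : D0 Q] : D0 (fun a xs => P a xs → Q a xs) := by
  obtain ⟨φ, h₁, hφ⟩ := hP
  obtain ⟨ψ, h₂, hψ⟩ := hQ
  refine ⟨φ.imp ψ, h₁.imp h₂, fun a xs => ?_⟩
  rw [BoundedFormula.realize_imp, hφ, hψ]

instance not [D0 P] : D0 (fun a xs => ¬ P a xs) :=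
  inferInstanceAs (D0 (fun a xs => P a xs → False))

instance and [D0 P] [D0 Q] : D0 (fun a xs => P a xs ∧ Q a xs) :=
  of_iff (fun a xs => ¬ (P a xs → ¬ Q a xs)) fun a xs => by tauto

instance or [D0 P] [D0 Q] : D0 (fun a xs => P a xs ∨ Q a xs) :=
  of_iff (fun a xs => ¬ P a xs → Q a xs) fun a xs => by tauto

instance iff [D0 P] [D0 Q] : D0 (fun a xs => P a xs ↔ Q a xs) :=
  of_iff (fun a xs => (P a xs → Q a xs) ∧ (Q a xs → P a xs)) fun a xs => by tauto

instance ball (f : (A → D) → (Fin n → D) → D) [hf : Tm0 f] {P : (A → D) → (Fin n → D) → D → Prop}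
    [hP : D0 (fun a (xs : Fin (n + 1) → D) => P a (fun i => xs i.castSucc) (xs (Fin.last n)))] :
    D0 (fun a xs => ∀ x, x ∈ f a xs → P a xs x) := by
  obtain ⟨t, ht⟩ := hf
  obtain ⟨φ, h₁, hφ⟩ := hP
  refine ⟨_, IsDelta0.ball t h₁, fun a xs => ?_⟩
  rw [BoundedFormula.realize_all]
  refine forall_congr' fun x => ?_
  rw [BoundedFormula.realize_imp, hφ]
  have e₁ : (fun i => (Fin.snoc xs x : Fin (n + 1) → D) (Fin.castSucc i)) = xs := by
    funext i
    simp
  have e₂ : Sum.elim a (Fin.snoc xs x : Fin (n + 1) → D) (Sum.map id Fin.castSucc t) = f a xs := by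
    rw [← ht]
    cases t <;> simp
  rw [e₁, Fin.snoc_last, ← e₂]
  refine imp_congr_left (Iff.trans (b := (Fin.snoc xs x : Fin (n + 1) → D) (Fin.last n) ∈
    Sum.elim a (Fin.snoc xs x : Fin (n + 1) → D) (Sum.map id Fin.castSucc t)) Iff.rfl ?_)
  rw [Fin.snoc_last]

instance bex (f : (A → D) → (Fin n → D) → D) [hf : Tm0 f] {P : (A → D) → (Fin n → D) → D → Prop}
    [hP : D0 (fun a (xs : Fin (n + 1) → D) => P a (fun i => xs i.castSucc) (xs (Fin.last n)))] :
    D0 (fun a xs => ∃ x, x ∈ f a xs ∧ P a xs x) :=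
  of_iff (fun a xs => ¬ ∀ x, x ∈ f a xs → ¬ P a xs x) fun a xs => by
    simp only [not_forall, not_not, exists_prop]

end D0

/-- `q = ⟨x, y⟩`, with bounded quantifiers. -/
def IsOPair0 (q x y : D) : Prop :=
  (∃ w, w ∈ q ∧ x ∈ w ∧ ∀ z, z ∈ w → z = x) ∧
  (∃ w, w ∈ q ∧ x ∈ w ∧ y ∈ w ∧ ∀ z, z ∈ w → z = x ∨ z = y) ∧
  ∀ w, w ∈ q → (x ∈ w ∧ ∀ z, z ∈ w → z = x) ∨ (x ∈ w ∧ y ∈ w ∧ ∀ z, z ∈ w → z = x ∨ z = y)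

theorem Adj.isOPair0_iff (h : Adj D) {q x y : D} : IsOPair0 q x y ↔ q = h.op x y := by
  have e₁ : ∀ w, (x ∈ w ∧ ∀ z, z ∈ w → z = x) ↔ w = h.upair x x := by
    intro w
    rw [← h.upair_iff]
    exact ⟨fun ⟨h₁, h₂⟩ z => ⟨fun hz => Or.inl (h₂ z hz), fun hz => by
      rcases hz with rfl | rfl <;> exact h₁⟩, fun H => ⟨(H x).2 (Or.inl rfl), fun z hz => by
      simpa using (H z).1 hz⟩⟩
  have e₂ : ∀ w, (x ∈ w ∧ y ∈ w ∧ ∀ z, z ∈ w → z = x ∨ z = y) ↔ w = h.upair x y := by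
    intro w
    rw [← h.upair_iff]
    exact ⟨fun ⟨h₁, h₂, h₃⟩ z => ⟨h₃ z, fun hz => by
      rcases hz with rfl | rfl <;> assumption⟩, fun H => ⟨(H x).2 (Or.inl rfl),
      (H y).2 (Or.inr rfl), fun z => (H z).1⟩⟩
  unfold IsOPair0
  simp only [e₁, e₂, exists_eq_right]
  constructor
  · rintro ⟨h₁, h₂, h₃⟩
    refine h.ext _ _ fun w => ⟨fun hw => h.mem_op.2 (h₃ w hw), fun hw => ?_⟩
    rcases h.mem_op.1 hw with rfl | rfl <;> assumption
  · rintro rfl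
    exact ⟨h.mem_op.2 (Or.inl rfl), h.mem_op.2 (Or.inr rfl), fun w hw => h.mem_op.1 hw⟩

/-- Pairs in `e` and `e'` agree in the first coordinate just if they agree in the second. -/
def Matching (e e' : D) : Prop :=
  ∀ q, q ∈ e → ∀ q', q' ∈ e' → ∀ w, w ∈ q → ∀ x, x ∈ w → ∀ y, y ∈ w →
    ∀ w', w' ∈ q' → ∀ x', x' ∈ w' → ∀ y', y' ∈ w' →
      IsOPair0 q x y → IsOPair0 q' x' y' → (x = x' ↔ y = y')

/-- `e` assigns an ordinal to each element of `z`. -/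
def Indexes (e z : D) : Prop :=
  ∀ x, x ∈ z → ∃ q, q ∈ e ∧ ∃ w, w ∈ q ∧ ∃ b, b ∈ w ∧ (IsOPair0 q x b ∧ IsOrd b)

instance : D0 (fun (a : Fin 2 → D) (_ : Fin 0 → D) => Matching (a 0) (a 1)) := by
  unfold Matching IsOPair0
  infer_instance

instance : D0 (fun (a : Fin 2 → D) (_ : Fin 0 → D) => Indexes (a 0) (a 1)) := by
  unfold Indexes IsOPair0 IsOrd IsTrans
  infer_instance

theorem Adj.matching_iff (h : Adj D) {e e' : D} : Matching e e' ↔ ∀ x y x' y' : D,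
    h.op x y ∈ e → h.op x' y' ∈ e' → (x = x' ↔ y = y') := by
  unfold Matching
  simp only [h.isOPair0_iff]
  constructor
  · intro H x y x' y' hxy hxy'
    exact H _ hxy _ hxy' (h.upair x y) (h.mem_op.2 (Or.inr rfl)) x (by simp) y (by simp)
      (h.upair x' y') (h.mem_op.2 (Or.inr rfl)) x' (by simp) y' (by simp) rfl rfl
  · rintro H q hq q' hq' - - x - y - - - x' - y' - rfl rfl
    exact H x y x' y' hq hq'

theorem Adj.indexes_iff (h : Adj D) {e z : D} : Indexes e z ↔ ∀ x : D, x ∈ z →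
    ∃ b : D, h.op x b ∈ e ∧ IsOrd b := by
  unfold Indexes
  simp only [h.isOPair0_iff]
  refine forall₂_congr fun x _ => ⟨?_, ?_⟩
  · rintro ⟨q, hq, -, -, b, -, rfl, hb⟩
    exact ⟨b, hq, hb⟩
  · rintro ⟨b, hq, hb⟩
    exact ⟨_, hq, h.upair x b, h.mem_op.2 (Or.inr rfl), b, by simp, rfl, hb⟩

end BoundedFormulas

variable {V : Type u} [Membership V V] {lam Hs : V}

theorem IsDelta0Embedding.iff {k : HSet lam → HSet lam} (hk : IsDelta0Embedding k) {n : ℕ}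
    (P : (Fin n → HSet lam) → (Fin 0 → HSet lam) → Prop) [hP : D0 P] (a : Fin n → HSet lam) :
    P a default ↔ P (k ∘ a) default := by
  obtain ⟨φ, h₁, hφ⟩ := hP
  rw [← hφ, ← hφ]
  exact hk n φ h₁ a

theorem Emb.mem_act {k : Emb lam} {p : SmallClass lam} {y : HSet lam} :
    y ∈ k.act p ↔ ∃ z : HSet lam, (∀ w : HSet lam, w ∈ z → w ∈ p.carrier) ∧ y ∈ k z := by
  constructor
  · rintro ⟨x, z, hz, hy⟩
    exact ⟨z, fun w hw => ((hz w).1 hw).1, hy⟩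
  · rintro ⟨z, hz, hy⟩
    exact ⟨z, z, fun w => ⟨fun hw => ⟨hz w hw, hw⟩, fun hw => hw.2⟩, hy⟩

namespace Ctx

variable (h : Ctx lam Hs)
include h

theorem exists_image_class {k : HSet lam → HSet lam} (hk : IsInternal k) (p : HClass lam) :
    ∃ Q : HClass lam, ∀ y : HSet lam, y ∈ Q.carrier ↔
      ∃ z : HSet lam, (∀ w : HSet lam, w ∈ z → w ∈ p.carrier) ∧ y ∈ k z := by
  obtain ⟨K, hK, -⟩ := h.exists_graph_class hk
  obtain ⟨Q, hQ⟩ := h.exists_class (fun (W : Fin 2 → Set (HSet lam)) w =>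
    ∃ z z', (∀ t, t ∈ z → t ∈ W 0) ∧ Fn (W 1) z z' ∧ w 0 ∈ z') ![p, K] (fun _ => h.lamH)
  refine ⟨Q, fun y => (hQ y).trans ⟨?_, ?_⟩⟩
  · rintro ⟨z, z', hz, hz', hy⟩
    exact ⟨z, hz, (hK _ _).1 hz' ▸ hy⟩
  · rintro ⟨z, hz, hy⟩
    exact ⟨z, k z, hz, (hK _ _).2 rfl, hy⟩

/-- For an index F of p, the class E = k⁺(F) indexes k⁺(p). Since k need not act elementarily on
classes, this is checked on pieces in H: being a one-to-one relation is the Δ₀ condition `Matching`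
on two pieces of F, and totality is the Δ₀ condition `Indexes` on a piece of F and its domain. -/
theorem exists_act_eq (k : Emb lam) (p : SmallClass lam) :
    ∃ q : SmallClass lam, k.act p = q.carrier := by
  obtain ⟨F, F₁, F₂, F₃, F₄⟩ := h.exists_index p.2
  obtain ⟨Q, hQ⟩ := h.exists_image_class k.2.1 p.1
  obtain ⟨E, hE⟩ := h.exists_image_class k.2.1 F
  have hfn : ∀ y b : HSet lam, PairMem E.1 y.1 b.1 ↔
      ∃ z : HSet lam, (∀ w : HSet lam, w ∈ z → w ∈ F.carrier) ∧ h.hadj.op y b ∈ k z := by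
    intro y b
    rw [← h.fn_coe, h.hadj.fn_iff]
    exact hE _
  have hmatch : ∀ x y x' y' : HSet lam, PairMem E.1 x.1 y.1 → PairMem E.1 x'.1 y'.1 →
      (x = x' ↔ y = y') := by
    intro x y x' y' hxy hxy'
    obtain ⟨z, hz, hxy⟩ := (hfn _ _).1 hxy
    obtain ⟨z', hz', hxy'⟩ := (hfn _ _).1 hxy'
    refine h.hadj.matching_iff.1 ((k.2.2.iff (fun a _ => Matching (a 0) (a 1)) ![z, z']).1
      (h.hadj.matching_iff.2 fun x y x' y' hxy hxy' => ?_)) x y x' y' hxy hxy'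
    have e := h.hadj.fn_iff.2 (hz _ hxy)
    have e' := h.hadj.fn_iff.2 (hz' _ hxy')
    constructor
    · rintro rfl
      exact F₂ _ _ _ e e'
    · rintro rfl
      exact F₃ _ _ _ e e'
  obtain ⟨l, hl, -⟩ := id p.2
  refine ⟨⟨Q, l, hl, h.zf.cardLE_of (fun x y => PairMem E.1 x y ∧ y ∈ Hs) ?_ ?_ ?_⟩, ?_⟩
  · intro y hy
    obtain ⟨z, hz, hyz⟩ := (hQ ⟨y, Q.2 y hy⟩).1 hy
    -- `e` is F restricted to `z`; it is in H, so k can be applied to it.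
    obtain ⟨e, he⟩ := h.exists_graph (fun x b => PairMem F.1 x b) z.2.cardLE
      (fun x hx => z.2.mem hx) (fun x b b' hx hb hb' e e' => congrArg Subtype.val
        (F₂ ⟨x, z.2.mem hx⟩ ⟨b, hb⟩ ⟨b', hb'⟩ (h.fn_coe.2 e) (h.fn_coe.2 e')))
    have heF : ∀ w : HSet lam, w ∈ e → w ∈ F.carrier := by
      intro w hw
      obtain ⟨x, b, -, -, hF, hwx⟩ := (he _).1 hw
      rw [h.zf.adj.pairMem_iff, ← h.zf.adj.isOPair_iff.1 hwx] at hF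
      exact hF
    have hind : Indexes e z := by
      refine h.hadj.indexes_iff.2 fun x hx => ?_
      obtain ⟨b, hb, hxb⟩ := F₁ x (hz x hx)
      refine ⟨b, (he _).2 ⟨x.1, b.1, hx, b.2, h.fn_coe.1 hxb, ?_⟩, hb⟩
      exact h.isOPair_coe.2 (h.hadj.isOPair_iff.2 rfl)
    obtain ⟨b, hb, hbo⟩ := h.hadj.indexes_iff.1
      ((k.2.2.iff (fun a _ => Indexes (a 0) (a 1)) ![e, z]).1 hind) _ hyz
    refine ⟨b.1, ?_, (hfn ⟨y, Q.2 y hy⟩ b).2 ⟨e, heF, hb⟩, (h.mem_iff _).2 b.2⟩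
    -- An ordinal in H is below λ⁺, as otherwise λ⁺ would inject into λ.
    rcases h.zf.trichotomy (isOrd_coe.2 hbo) hl.1 with e | e | e
    · exact e
    · exact absurd (e ▸ b.2.cardLE) hl.2.1
    · exact absurd (b.2.mem e).cardLE hl.2.1
  · rintro x y y' hx - - ⟨e, hy⟩ ⟨e', hy'⟩
    exact congrArg Subtype.val ((hmatch ⟨x, Q.2 x hx⟩ ⟨y, (h.mem_iff _).1 hy⟩ ⟨x, Q.2 x hx⟩
      ⟨y', (h.mem_iff _).1 hy'⟩ e e').1 rfl)
  · rintro x x' y hx hx' - ⟨e, hy⟩ ⟨e', -⟩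
    exact congrArg Subtype.val ((hmatch ⟨x, Q.2 x hx⟩ ⟨y, (h.mem_iff _).1 hy⟩ ⟨x', Q.2 x' hx'⟩
      ⟨y, (h.mem_iff _).1 hy⟩ e e').2 rfl)
  · ext y
    rw [Emb.mem_act]
    exact (hQ y).symm

end Ctx

end SetAction

/-! ### Truth classes for coded Δ₀ formulas. -/

namespace SetAction

universe u v

set_option synthInstance.maxSize 100000
set_option synthInstance.maxHeartbeats 400000

section Truth

variable {D : Type u} [Membership D D]

/-- `i = ⟨t, ⟨x, y⟩⟩`. -/
def IsTriple (t x y i : D) : Prop := ∃ p, IsOPair p x y ∧ IsOPair i t p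

/-- `s' = s ∪ {⟨y, b⟩}`. -/
def IsUpdate (s y b s' : D) : Prop := ∃ q, IsOPair q y b ∧ ∀ z, z ∈ s' ↔ z ∈ s ∨ z = q

/-- One step in the evaluation of coded `Δ₀` formulas in negation normal form. A pair `⟨i, s⟩` says
that the formula with code `i` holds under the assignment `s`, a set of pairs of a variable and its
value; `S` is the class of such pairs found so far. -/
def TruthStep (τ : Fin 8 → D) (S : Set D) (u : D) : Prop :=
  ∃ i s, IsOPair u i s ∧
    ((∃ x y, IsTriple (τ 0) x y i ∧ ∃ a b, PairMem s x a ∧ PairMem s y b ∧ a ∈ b) ∨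
    (∃ x y, IsTriple (τ 1) x y i ∧ ∃ a b, PairMem s x a ∧ PairMem s y b ∧ a ∉ b) ∨
    (∃ x y, IsTriple (τ 2) x y i ∧ ∃ a b, PairMem s x a ∧ PairMem s y b ∧ a = b) ∨
    (∃ x y, IsTriple (τ 3) x y i ∧ ∃ a b, PairMem s x a ∧ PairMem s y b ∧ a ≠ b) ∨
    (∃ k l, IsTriple (τ 4) k l i ∧ Fn S k s ∧ Fn S l s) ∨
    (∃ k l, IsTriple (τ 5) k l i ∧ (Fn S k s ∨ Fn S l s)) ∨
    (∃ x p y k, IsTriple (τ 6) x p i ∧ IsOPair p y k ∧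
      ∀ a, PairMem s x a → ∀ b, b ∈ a → ∀ s', IsUpdate s y b s' → Fn S k s') ∨
    (∃ x p y k, IsTriple (τ 7) x p i ∧ IsOPair p y k ∧
      ∃ a, PairMem s x a ∧ ∃ b, b ∈ a ∧ ∃ s', IsUpdate s y b s' ∧ Fn S k s'))

/-- This is the purpose of negation normal form: with negation pushed to the atoms, `S` occurs only
positively, and a fixed point exists. -/
theorem TruthStep.mono {τ : Fin 8 → D} {S T : Set D} (hST : S ⊆ T) {u : D}
    (h : TruthStep τ S u) : TruthStep τ T u := by
  have hfn : ∀ {x y : D}, Fn S x y → Fn T x y := fun ⟨q, hq, e⟩ => ⟨q, hST hq, e⟩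
  obtain ⟨i, s, hu, h⟩ := h
  refine ⟨i, s, hu, ?_⟩
  rcases h with h | h | h | h | ⟨k, l, e, h₁, h₂⟩ | ⟨k, l, e, h₁⟩ | ⟨x, p, y, k, e, e', h₁⟩ |
    ⟨x, p, y, k, e, e', a, ha, b, hb, s', hs', h₁⟩
  · exact Or.inl h
  · exact Or.inr (Or.inl h)
  · exact Or.inr (Or.inr (Or.inl h))
  · exact Or.inr (Or.inr (Or.inr (Or.inl h)))
  · exact Or.inr (Or.inr (Or.inr (Or.inr (Or.inl ⟨k, l, e, hfn h₁, hfn h₂⟩))))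
  · exact Or.inr (Or.inr (Or.inr (Or.inr (Or.inr (Or.inl ⟨k, l, e, h₁.imp hfn hfn⟩)))))
  · exact Or.inr (Or.inr (Or.inr (Or.inr (Or.inr (Or.inr (Or.inl ⟨x, p, y, k, e, e',
      fun a ha b hb s' hs' => hfn (h₁ a ha b hb s' hs')⟩))))))
  · exact Or.inr (Or.inr (Or.inr (Or.inr (Or.inr (Or.inr (Or.inr ⟨x, p, y, k, e, e',
      a, ha, b, hb, s', hs', hfn h₁⟩))))))

instance Ex.truthStep {C : Type} {A G : Type v} {cv : G → C → Set D} {pv : G → A → D} (X : C)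
    (τ : Fin 8 → G → (ℕ → D) → D) (f : G → (ℕ → D) → D) [hτ : ∀ i, Tm pv (τ i)] [hf : Tm pv f] :
    Ex cv pv (fun g w => TruthStep (fun i => τ i g w) (cv g X) (f g w)) := by
  -- The argument and the eight tags are first made variables 0 to 8, then replaced by the given
  -- terms.
  have h₀ : Ex cv pv (fun g w => TruthStep (fun i : Fin 8 => w (i.1 + 1)) (cv g X) (w 0)) := by
    unfold TruthStep IsTriple IsUpdate
    infer_instance
  let t : ℕ → G → (ℕ → D) → D
    | 0 => f
    | i + 1 => if h : i < 8 then τ ⟨i, h⟩ else f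
  have ht : ∀ i, Tm pv (t i) := by
    rintro (_ | i)
    · exact hf
    · by_cases h : i < 8
      · simpa only [t, h, dite_true] using hτ ⟨i, h⟩
      · simpa only [t, h, dite_false] using hf
  have := Ex.comp _ t ht (hP := h₀)
  refine Ex.of_iff _ (h := this) fun g w => ?_
  have e : (fun i : Fin 8 => t (i.1 + 1) g w) = fun i => τ i g w := by
    funext i
    simp [t]
  exact iff_of_eq (congrArg (fun τ => TruthStep τ (cv g X) (f g w)) e)

namespace Adj

variable (h : Adj D)

/-- The iterated singletons of the empty set. -/
noncomputable def numeral (h : Adj D) : ℕ → D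
  | 0 => h.empty
  | n + 1 => h.upair (numeral h n) (numeral h n)

theorem numeral_injective : Function.Injective h.numeral := by
  intro m
  induction m with
  | zero =>
    intro n e
    cases n with
    | zero => rfl
    | succ n =>
      exact absurd (e ▸ h.mem_upair.2 (Or.inl rfl) : h.numeral n ∈ h.numeral 0)
        (h.notMem_empty _)
  | succ m ih =>
    intro n e
    cases n with
    | zero =>
      exact absurd (e ▸ h.mem_upair.2 (Or.inl rfl) : h.numeral m ∈ h.numeral 0)
        (h.notMem_empty _)
    | succ n => rw [ih (h.upair_self_eq e).1]

include h in
theorem infinite : Infinite D := Infinite.of_injective _ h.numeral_injective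

/-- The code `⟨t, ⟨x, y⟩⟩`. -/
noncomputable def triple (t x y : D) : D := h.op t (h.op x y)

section FixedPoint

variable {τ : Fin 8 → D} (hτ : Function.Injective τ) {Z : Set D}
  (hZ : ∀ u, u ∈ Z ↔ TruthStep τ Z u)
include hτ hZ

theorem truth_zero (x y s : D) : h.op (h.triple (τ 0) x y) s ∈ Z ↔
    ∃ a b, h.op x a ∈ s ∧ h.op y b ∈ s ∧ a ∈ b := by
  rw [hZ]
  simp [TruthStep, IsTriple, h.isOPair_iff, h.pairMem_iff, triple, hτ.eq_iff]

theorem truth_one (x y s : D) : h.op (h.triple (τ 1) x y) s ∈ Z ↔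
    ∃ a b, h.op x a ∈ s ∧ h.op y b ∈ s ∧ a ∉ b := by
  rw [hZ]
  simp [TruthStep, IsTriple, h.isOPair_iff, h.pairMem_iff, triple, hτ.eq_iff]

theorem truth_two (x y s : D) : h.op (h.triple (τ 2) x y) s ∈ Z ↔
    ∃ a b, h.op x a ∈ s ∧ h.op y b ∈ s ∧ a = b := by
  rw [hZ]
  simp [TruthStep, IsTriple, h.isOPair_iff, h.pairMem_iff, triple, hτ.eq_iff]

theorem truth_three (x y s : D) : h.op (h.triple (τ 3) x y) s ∈ Z ↔
    ∃ a b, h.op x a ∈ s ∧ h.op y b ∈ s ∧ a ≠ b := by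
  rw [hZ]
  simp [TruthStep, IsTriple, h.isOPair_iff, h.pairMem_iff, triple, hτ.eq_iff]

theorem truth_four (k l s : D) : h.op (h.triple (τ 4) k l) s ∈ Z ↔
    h.op k s ∈ Z ∧ h.op l s ∈ Z := by
  rw [hZ]
  simp [TruthStep, IsTriple, h.isOPair_iff, h.pairMem_iff, triple, hτ.eq_iff, h.fn_iff]

theorem truth_five (k l s : D) : h.op (h.triple (τ 5) k l) s ∈ Z ↔
    h.op k s ∈ Z ∨ h.op l s ∈ Z := by
  rw [hZ]
  simp [TruthStep, IsTriple, h.isOPair_iff, h.pairMem_iff, triple, hτ.eq_iff, h.fn_iff]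

theorem truth_six (x y k s : D) : h.op (h.triple (τ 6) x (h.op y k)) s ∈ Z ↔
    ∀ a, h.op x a ∈ s → ∀ b, b ∈ a → h.op k (h.insert s (h.op y b)) ∈ Z := by
  have hup : ∀ b s', (∀ z, z ∈ s' ↔ z ∈ s ∨ z = h.op y b) ↔ s' = h.insert s (h.op y b) :=
    fun b s' => ⟨fun e => h.eq_insert e, fun e z => by rw [e, h.mem_insert]⟩
  rw [hZ]
  simp [TruthStep, IsTriple, IsUpdate, h.isOPair_iff, h.pairMem_iff, triple, hτ.eq_iff, h.fn_iff,
    hup]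

theorem truth_seven (x y k s : D) : h.op (h.triple (τ 7) x (h.op y k)) s ∈ Z ↔
    ∃ a, h.op x a ∈ s ∧ ∃ b, b ∈ a ∧ h.op k (h.insert s (h.op y b)) ∈ Z := by
  have hup : ∀ b s', (∀ z, z ∈ s' ↔ z ∈ s ∨ z = h.op y b) ↔ s' = h.insert s (h.op y b) :=
    fun b s' => ⟨fun e => h.eq_insert e, fun e z => by rw [e, h.mem_insert]⟩
  rw [hZ]
  simp [TruthStep, IsTriple, IsUpdate, h.isOPair_iff, h.pairMem_iff, triple, hτ.eq_iff, h.fn_iff,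
    hup]

end FixedPoint

/-- `s` is the assignment of the value `a t` to the variable named `x t`. -/
def IsEnv {ι : Type*} (x a : ι → D) (s : D) : Prop := ∀ q, q ∈ s ↔ ∃ t, q = h.op (x t) (a t)

/-- The code `i` with variables named `x` stands for `P`. -/
def Codes {ι : Type*} (Z : Set D) (i : D) (x : ι → D) (P : (ι → D) → Prop) : Prop :=
  ∀ a s, h.IsEnv x a s → (h.op i s ∈ Z ↔ P a)

variable {h}

theorem IsEnv.op_mem_iff {ι : Type*} {x a : ι → D} {s : D} (hs : h.IsEnv x a s) {y b : D} :
    h.op y b ∈ s ↔ ∃ t, y = x t ∧ b = a t := by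
  rw [hs]
  simp

theorem IsEnv.op_mem_iff_eq {ι : Type*} {x a : ι → D} {s : D} (hs : h.IsEnv x a s)
    (hx : Function.Injective x) {t : ι} {b : D} : h.op (x t) b ∈ s ↔ b = a t := by
  rw [hs.op_mem_iff]
  simp [hx.eq_iff]

/-- Adds a bound variable. -/
def extend {A : Type*} {n : ℕ} (x : A ⊕ Fin n → D) (y : D) : A ⊕ Fin (n + 1) → D :=
  Sum.elim (fun t => x (Sum.inl t)) (Fin.snoc (fun t => x (Sum.inr t)) y)

omit [Membership D D] in
theorem extend_comp {A : Type*} {n : ℕ} (x : A ⊕ Fin n → D) (y : D) (k : D → D) :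
    extend (k ∘ x) (k y) = k ∘ extend x y := by
  funext t
  rcases t with t | t
  · rfl
  · refine Fin.lastCases ?_ (fun i => ?_) t <;> simp [extend]

omit [Membership D D] in
theorem extend_injective {A : Type*} {n : ℕ} {x : A ⊕ Fin n → D} (hx : Function.Injective x) {y : D}
    (hy : ∀ t, x t ≠ y) : Function.Injective (extend x y) := by
  have key : ∀ t : A ⊕ Fin (n + 1), t = Sum.inr (Fin.last n) ∧ extend x y t = y ∨
      ∃ t', t = Sum.map id Fin.castSucc t' ∧ extend x y t = x t' := by
    rintro (t | t)
    · exact Or.inr ⟨Sum.inl t, rfl, rfl⟩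
    · refine Fin.lastCases (Or.inl ⟨rfl, by simp [extend]⟩)
        (fun i => Or.inr ⟨Sum.inr i, rfl, by simp [extend]⟩) t
  intro t t' e
  rcases key t with ⟨ht, e₁⟩ | ⟨u, ht, e₁⟩ <;> rcases key t' with ⟨ht', e₂⟩ | ⟨u', ht', e₂⟩
  · rw [ht, ht']
  · exact absurd (e₂.symm.trans (e.symm.trans e₁)) (hy _)
  · exact absurd (e₁.symm.trans (e.trans e₂)) (hy _)
  · rw [ht, ht', hx (e₁.symm.trans (e.trans e₂))]

theorem IsEnv.insert {A : Type*} {n : ℕ} {x a : A ⊕ Fin n → D} {s : D} (hs : h.IsEnv x a s)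
    (y b : D) : h.IsEnv (extend x y) (extend a b) (h.insert s (h.op y b)) := by
  intro q
  rw [h.mem_insert, hs]
  constructor
  · rintro (⟨t | t, rfl⟩ | rfl)
    · exact ⟨Sum.inl t, rfl⟩
    · exact ⟨Sum.inr t.castSucc, by simp [extend]⟩
    · exact ⟨Sum.inr (Fin.last n), by simp [extend]⟩
  · rintro ⟨t | t, rfl⟩
    · exact Or.inl ⟨Sum.inl t, rfl⟩
    · refine Fin.lastCases (Or.inr (by simp [extend]))
        (fun i => Or.inl ⟨Sum.inr i, by simp [extend]⟩) t

/-- A finite assignment is built by finitely many adjunctions, each of which k respects; so its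
image assigns the moved values to the moved names. -/
theorem exists_isEnv {ι : Type*} [Finite ι] {k : D → D} (k₀ : k h.empty = h.empty)
    (k₁ : ∀ s t, k (h.insert s t) = h.insert (k s) (k t))
    (k₂ : ∀ x y, k (h.op x y) = h.op (k x) (k y)) (x a : ι → D) :
    ∃ s, h.IsEnv x a s ∧ h.IsEnv (k ∘ x) (k ∘ a) (k s) := by
  classical
  have := Fintype.ofFinite ι
  have key : ∀ S : Finset ι, ∃ s, (∀ q, q ∈ s ↔ ∃ t ∈ S, q = h.op (x t) (a t)) ∧
      ∀ q, q ∈ k s ↔ ∃ t ∈ S, q = h.op (k (x t)) (k (a t)) := by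
    intro S
    induction S using Finset.induction_on with
    | empty => exact ⟨h.empty, fun q => by simp [h.notMem_empty], fun q => by
        simp [k₀, h.notMem_empty]⟩
    | insert t S _ ih =>
      obtain ⟨s, h₁, h₂⟩ := ih
      refine ⟨h.insert s (h.op (x t) (a t)), fun q => ?_, fun q => ?_⟩
      · rw [h.mem_insert, h₁]
        simp [or_comm]
      · rw [k₁, k₂, h.mem_insert, h₂]
        simp [or_comm]
  obtain ⟨s, h₁, h₂⟩ := key Finset.univ
  exact ⟨s, fun q => by simpa using h₁ q, fun q => by simpa using h₂ q⟩

section Codes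

variable {τ : Fin 8 → D} (hτ : Function.Injective τ) {Z : Set D}
  (hZ : ∀ u, u ∈ Z ↔ TruthStep τ Z u)
include hτ hZ

variable {ι : Type*} {x : ι → D}

theorem codes_mem (hx : Function.Injective x) (t t' : ι) :
    h.Codes Z (h.triple (τ 0) (x t) (x t')) x (fun a => a t ∈ a t') := by
  intro a s hs
  rw [truth_zero h hτ hZ]
  simp [hs.op_mem_iff_eq hx]

theorem codes_notMem (hx : Function.Injective x) (t t' : ι) :
    h.Codes Z (h.triple (τ 1) (x t) (x t')) x (fun a => ¬ a t ∈ a t') := by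
  intro a s hs
  rw [truth_one h hτ hZ]
  simp [hs.op_mem_iff_eq hx]

theorem codes_eq (hx : Function.Injective x) (t t' : ι) :
    h.Codes Z (h.triple (τ 2) (x t) (x t')) x (fun a => a t = a t') := by
  intro a s hs
  rw [truth_two h hτ hZ]
  simp [hs.op_mem_iff_eq hx]

theorem codes_ne (hx : Function.Injective x) (t t' : ι) :
    h.Codes Z (h.triple (τ 3) (x t) (x t')) x (fun a => ¬ a t = a t') := by
  intro a s hs
  rw [truth_three h hτ hZ]
  simp [hs.op_mem_iff_eq hx]

/-- An unused name `y` has no value, so an atomic formula about it fails; for the same reason a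
universal quantifier bounded by it holds vacuously in `codes_true`. -/
theorem codes_false {y : D} (hy : ∀ t, x t ≠ y) :
    h.Codes Z (h.triple (τ 0) y y) x (fun _ => False) := by
  intro a s hs
  rw [truth_zero h hτ hZ]
  simp [hs.op_mem_iff, (hy _).symm]

theorem codes_true {y : D} (hy : ∀ t, x t ≠ y) :
    h.Codes Z (h.triple (τ 6) y (h.op y y)) x (fun _ => ¬ False) := by
  intro a s hs
  rw [truth_six h hτ hZ]
  simp [hs.op_mem_iff, (hy _).symm]

theorem Codes.and {P Q : (ι → D) → Prop} {k l : D} (hP : h.Codes Z k x P) (hQ : h.Codes Z l x Q) :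
    h.Codes Z (h.triple (τ 4) k l) x (fun a => P a ∧ Q a) := by
  intro a s hs
  rw [truth_four h hτ hZ, hP a s hs, hQ a s hs]

theorem Codes.or {P Q : (ι → D) → Prop} {k l : D} (hP : h.Codes Z k x P) (hQ : h.Codes Z l x Q) :
    h.Codes Z (h.triple (τ 5) k l) x (fun a => P a ∨ Q a) := by
  intro a s hs
  rw [truth_five h hτ hZ, hP a s hs, hQ a s hs]

omit ι x in
variable {A : Type*} {n : ℕ} {x : A ⊕ Fin n → D} in
theorem Codes.ball {P : (A ⊕ Fin (n + 1) → D) → Prop} {k y : D} (hx : Function.Injective x)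
    (hP : h.Codes Z k (extend x y) P) (t : A ⊕ Fin n) :
    h.Codes Z (h.triple (τ 6) (x t) (h.op y k)) x (fun a => ∀ b, b ∈ a t → P (extend a b)) := by
  intro a s hs
  rw [truth_six h hτ hZ]
  simp only [hs.op_mem_iff_eq hx, forall_eq]
  exact forall₂_congr fun b _ => hP _ _ (hs.insert y b)

omit ι x in
variable {A : Type*} {n : ℕ} {x : A ⊕ Fin n → D} in
theorem Codes.bex {P : (A ⊕ Fin (n + 1) → D) → Prop} {k y : D} (hx : Function.Injective x)
    (hP : h.Codes Z k (extend x y) P) (t : A ⊕ Fin n) :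
    h.Codes Z (h.triple (τ 7) (x t) (h.op y k)) x (fun a => ∃ b, b ∈ a t ∧ P (extend a b)) := by
  intro a s hs
  rw [truth_seven h hτ hZ]
  simp only [hs.op_mem_iff_eq hx, exists_eq_left]
  exact exists_congr fun b => and_congr_right fun _ => hP _ _ (hs.insert y b)

end Codes

-- Induction on actual formulas, so it does not matter whether the natural numbers of the model are
-- standard. Codes are built by pairing from fixed tags and variable names, hence k turns a code
-- into the code of the same formula with names moved by k. A code `d` for the negation is carried
-- along because implication needs it in negation normal form.
open FirstOrder FirstOrder.Language in
theorem exists_codes {τ : Fin 8 → D} (hτ : Function.Injective τ) {Z Z' : Set D}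
    (hZ : ∀ u, u ∈ Z ↔ TruthStep τ Z u) (hZ' : ∀ u, u ∈ Z' ↔ TruthStep τ Z' u)
    {k : D → D} (hk : Function.Injective k) (kτ : ∀ i, k (τ i) = τ i)
    (k₂ : ∀ x y, k (h.op x y) = h.op (k x) (k y)) {A : Type} [Finite A] {n : ℕ}
    {φ : (setLang Empty).BoundedFormula A n} (hφ : IsDelta0 φ) :
    ∀ x : A ⊕ Fin n → D, Function.Injective x → ∃ c d : D,
      (h.Codes Z c x (fun a => φ.Realize (fun t => a (Sum.inl t)) fun t => a (Sum.inr t)) ∧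
        h.Codes Z' (k c) (k ∘ x) (fun a => φ.Realize (fun t => a (Sum.inl t)) fun t => a (Sum.inr t))) ∧
      h.Codes Z d x (fun a => ¬ φ.Realize (fun t => a (Sum.inl t)) fun t => a (Sum.inr t)) ∧
        h.Codes Z' (k d) (k ∘ x)
          (fun a => ¬ φ.Realize (fun t => a (Sum.inl t)) fun t => a (Sum.inr t)) := by
  have := h.infinite
  have fresh : ∀ {m : ℕ} (x : A ⊕ Fin m → D), ∃ y, ∀ t, x t ≠ y := by
    intro m x
    obtain ⟨y, hy⟩ := (Set.finite_range x).exists_notMem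
    exact ⟨y, fun t e => hy ⟨t, e⟩⟩
  have k₃ : ∀ t x y, k (h.triple t x y) = h.triple (k t) (k x) (k y) := fun t x y => by
    simp only [triple, k₂]
  have hvar : ∀ {m : ℕ} (t : (setLang Empty).Term (A ⊕ Fin m)), ∃ b, t = Term.var b := by
    intro m t
    cases t with
    | var b => exact ⟨b, rfl⟩
    | func f _ => exact Empty.elim f
  have hval : ∀ {m : ℕ} (a : A ⊕ Fin m → D) (b : A ⊕ Fin m),
      Sum.elim (fun t => a (Sum.inl t)) (fun t => a (Sum.inr t)) b = a b := by
    intro m a b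
    cases b <;> rfl
  induction hφ with
  | falsum =>
    intro x hx
    obtain ⟨y, hy⟩ := fresh x
    have hy' : ∀ t, (k ∘ x) t ≠ k y := fun t e => hy t (hk e)
    refine ⟨_, _, ⟨codes_false hτ hZ hy, ?_⟩, codes_true hτ hZ hy, ?_⟩
    · rw [k₃, kτ]
      exact codes_false hτ hZ' hy'
    · rw [k₃, kτ, k₂]
      exact codes_true hτ hZ' hy'
  | equal t₁ t₂ =>
    intro x hx
    obtain ⟨b₁, rfl⟩ := hvar t₁
    obtain ⟨b₂, rfl⟩ := hvar t₂
    simp only [BoundedFormula.Realize, Term.realize_var, hval]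
    refine ⟨_, _, ⟨codes_eq hτ hZ hx b₁ b₂, ?_⟩, codes_ne hτ hZ hx b₁ b₂, ?_⟩
    · rw [k₃, kτ]
      exact codes_eq hτ hZ' (hk.comp hx) b₁ b₂
    · rw [k₃, kτ]
      exact codes_ne hτ hZ' (hk.comp hx) b₁ b₂
  | rel R ts =>
    intro x hx
    cases R with
    | cls X => exact X.elim
    | mem =>
      choose b hb using fun i => hvar (ts i)
      have e : ∀ a : A ⊕ Fin _ → D, (BoundedFormula.rel (SetRel.mem : SetRel Empty 2) ts).Realize
          (fun t => a (Sum.inl t)) (fun t => a (Sum.inr t)) ↔ a (b 0) ∈ a (b 1) := by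
        intro a
        rw [← hval a (b 0), ← hval a (b 1)]
        simp only [BoundedFormula.Realize, hb]
        exact Iff.rfl
      refine ⟨h.triple (τ 0) (x (b 0)) (x (b 1)), h.triple (τ 1) (x (b 0)) (x (b 1)),
        ⟨fun a s hs => ?_, fun a s hs => ?_⟩, fun a s hs => ?_, fun a s hs => ?_⟩
      · exact (codes_mem hτ hZ hx _ _ a s hs).trans (e a).symm
      · rw [k₃, kτ]
        exact (codes_mem hτ hZ' (hk.comp hx) _ _ a s hs).trans (e a).symm
      · exact (codes_notMem hτ hZ hx _ _ a s hs).trans (not_congr (e a)).symm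
      · rw [k₃, kτ]
        exact (codes_notMem hτ hZ' (hk.comp hx) _ _ a s hs).trans (not_congr (e a)).symm
  | imp _ _ ih₁ ih₂ =>
    intro x hx
    obtain ⟨c₁, d₁, ⟨hc₁, hc₁'⟩, hd₁, hd₁'⟩ := ih₁ x hx
    obtain ⟨c₂, d₂, ⟨hc₂, hc₂'⟩, hd₂, hd₂'⟩ := ih₂ x hx
    refine ⟨h.triple (τ 5) d₁ c₂, h.triple (τ 4) c₁ d₂,
      ⟨fun a s hs => ?_, fun a s hs => ?_⟩, fun a s hs => ?_, fun a s hs => ?_⟩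
    · exact (hd₁.or hτ hZ hc₂ a s hs).trans imp_iff_not_or.symm
    · rw [k₃, kτ]
      exact (hd₁'.or hτ hZ' hc₂' a s hs).trans imp_iff_not_or.symm
    · exact (hc₁.and hτ hZ hd₂ a s hs).trans Classical.not_imp.symm
    · rw [k₃, kτ]
      exact (hc₁'.and hτ hZ' hd₂' a s hs).trans Classical.not_imp.symm
  | @ball m t φ _ ih =>
    intro x hx
    obtain ⟨y, hy⟩ := fresh x
    obtain ⟨c, d, ⟨hc, hc'⟩, hd, hd'⟩ := ih (extend x y) (extend_injective hx hy)
    rw [← extend_comp] at hc' hd'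
    have e : ∀ a : A ⊕ Fin m → D, (BoundedFormula.all
        ((BoundedFormula.rel (SetRel.mem : SetRel Empty 2) ![Term.var (Sum.inr (Fin.last m)),
          Term.var (Sum.map id Fin.castSucc t)]).imp φ)).Realize
          (fun t => a (Sum.inl t)) (fun t => a (Sum.inr t)) ↔ ∀ b, b ∈ a t →
          φ.Realize (fun t => extend a b (Sum.inl t)) fun t => extend a b (Sum.inr t) := by
      intro a
      rw [BoundedFormula.realize_all]
      refine forall_congr' fun b => ?_
      rw [BoundedFormula.realize_imp]
      refine imp_congr ?_ Iff.rfl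
      have e₂ : Sum.elim (fun t => a (Sum.inl t))
          (Fin.snoc (fun t => a (Sum.inr t)) b : Fin (m + 1) → D) (Sum.map id Fin.castSucc t) =
          a t := by
        cases t <;> simp
      refine Iff.trans (b := (Fin.snoc (fun t => a (Sum.inr t)) b : Fin (m + 1) → D) (Fin.last m) ∈
        Sum.elim (fun t => a (Sum.inl t)) (Fin.snoc (fun t => a (Sum.inr t)) b : Fin (m + 1) → D)
          (Sum.map id Fin.castSucc t)) Iff.rfl ?_
      rw [Fin.snoc_last, e₂]
    have e' : ∀ a : A ⊕ Fin m → D, (∃ b, b ∈ a t ∧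
        ¬ φ.Realize (fun t => extend a b (Sum.inl t)) fun t => extend a b (Sum.inr t)) ↔
        ¬ ∀ b, b ∈ a t →
          φ.Realize (fun t => extend a b (Sum.inl t)) fun t => extend a b (Sum.inr t) := by
      intro a
      simp only [not_forall, exists_prop]
    refine ⟨h.triple (τ 6) (x t) (h.op y c), h.triple (τ 7) (x t) (h.op y d),
      ⟨fun a s hs => ?_, fun a s hs => ?_⟩, fun a s hs => ?_, fun a s hs => ?_⟩
    · exact (hc.ball hτ hZ hx t a s hs).trans (e a).symm
    · rw [k₃, kτ, k₂]
      exact (hc'.ball hτ hZ' (hk.comp hx) t a s hs).trans (e a).symm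
    · exact ((hd.bex hτ hZ hx t a s hs).trans (e' a)).trans (not_congr (e a)).symm
    · rw [k₃, kτ, k₂]
      exact ((hd'.bex hτ hZ' (hk.comp hx) t a s hs).trans (e' a)).trans (not_congr (e a)).symm

open FirstOrder FirstOrder.Language in
/-- A map that carries one truth class for `Δ₀` formulas into another one is a `Δ₀` embedding. -/
theorem realize_iff_of_truth {τ : Fin 8 → D} (hτ : Function.Injective τ) {Z Z' : Set D}
    (hZ : ∀ u, u ∈ Z ↔ TruthStep τ Z u) (hZ' : ∀ u, u ∈ Z' ↔ TruthStep τ Z' u)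
    {k : D → D} (hk : Function.Injective k) (kτ : ∀ i, k (τ i) = τ i) (k₀ : k h.empty = h.empty)
    (k₁ : ∀ s t, k (h.insert s t) = h.insert (k s) (k t))
    (k₂ : ∀ x y, k (h.op x y) = h.op (k x) (k y))
    (hpres : ∀ u, u ∈ Z → k u ∈ Z') {n : ℕ} {φ : (setLang Empty).Formula (Fin n)}
    (hφ : IsDelta0 φ) (a : Fin n → D) : φ.Realize a ↔ φ.Realize (k ∘ a) := by
  have := h.infinite
  let x : Fin n ⊕ Fin 0 → D := fun t => h.numeral (Sum.elim (fun i => i.1) (fun i => i.1) t)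
  have hx : Function.Injective x := by
    rintro (i | i) (i' | i') e
    · exact congrArg _ (Fin.ext (h.numeral_injective e))
    · exact i'.elim0
    · exact i.elim0
    · exact i.elim0
  obtain ⟨c, d, ⟨hc, hc'⟩, hd, hd'⟩ := exists_codes hτ hZ hZ' hk kτ k₂ hφ x hx
  obtain ⟨s, hs, hs'⟩ := exists_isEnv k₀ k₁ k₂ x (Sum.elim a fun i => i.elim0)
  have e : ∀ b : Fin n → D, BoundedFormula.Realize φ b default ↔ φ.Realize b := fun b => Iff.rfl
  have e₁ : ∀ xs : Fin 0 → D, xs = default := fun xs => Subsingleton.elim _ _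
  have h₁ := hc _ _ hs
  have h₂ := hd _ _ hs
  have h₁' := hc' _ _ hs'
  have h₂' := hd' _ _ hs'
  simp only [e₁ (fun t => _), Sum.elim_inl, Function.comp_apply, e] at h₁ h₂ h₁' h₂'
  rw [← k₂] at h₁' h₂'
  constructor
  · exact fun H => h₁'.1 (hpres _ (h₁.2 H))
  -- Preservation in one direction gives reflection when applied to the code `d` of the negation.
  · intro H
    by_contra H'
    exact h₂'.1 (hpres _ (h₂.2 H')) H

end Adj

end Truth

end SetAction

/-! ### The statement to be reflected, as a formula with class variables. -/

namespace SetAction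

universe u v

set_option synthInstance.maxSize 100000
set_option synthInstance.maxHeartbeats 400000

namespace Adj

variable {D : Type u} [Membership D D] (h : Adj D) {k : D → D}
  (k₀ : k h.empty = h.empty) (k₁ : ∀ s t, k (h.insert s t) = h.insert (k s) (k t))
include k₀ k₁

theorem map_op_of_insert (x y : D) : k (h.op x y) = h.op (k x) (k y) := by
  simp only [op, upair, k₁, k₀]

theorem map_numeral_of_insert (n : ℕ) : k (h.numeral n) = h.numeral n := by
  induction n with
  | zero => exact k₀
  | succ n ih => simp only [numeral, upair, k₁, k₀, ih]

end Adj

section Reflection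

/-- `K` is the graph of an injective function that respects `∅` and `s, t ↦ s ∪ {t}`. -/
def IsEmbeddingGraph {D : Type u} [Membership D D] (K : Set D) : Prop :=
  (∀ q, q ∈ K → ∃ x y, IsOPair q x y) ∧
  (∀ x, ∃ y, Fn K x y ∧ ∀ z, Fn K x z → z = y) ∧
  (∀ x x' y, Fn K x y → Fn K x' y → x = x') ∧
  (∀ x y, (∀ z, z ∉ x) → Fn K x y → ∀ z, z ∉ y) ∧
  ∀ s t u s' t' u', (∀ z, z ∈ u ↔ z ∈ s ∨ z = t) → Fn K s s' → Fn K t t' → Fn K u u' →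
    ∀ z, z ∈ u' ↔ z ∈ s' ∨ z = t'

/-- The properties of the function with graph `K` that are to be reflected: it carries the truth
class `Z` for `Δ₀` formulas into the truth class `Z'`, acts on `X i` like the given embedding,
its critical point is an element of `κ`, and it maps its restriction to `v` to `s`. -/
def IsReflection {D : Type u} [Membership D D] {c : ℕ} (τ : Fin 8 → D) (κ v s : D)
    (X X' : Fin c → Set D) (K Z Z' : Set D) : Prop :=
  IsEmbeddingGraph K ∧
  (∀ u, u ∈ Z ↔ TruthStep τ Z u) ∧ (∀ u, u ∈ Z' ↔ TruthStep τ Z' u) ∧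
  (∀ u u', u ∈ Z → Fn K u u' → u' ∈ Z') ∧
  (∀ i, ∀ y, y ∈ X' i ↔ ∃ z z', (∀ w, w ∈ z → w ∈ X i) ∧ Fn K z z' ∧ y ∈ z') ∧
  (∃ μ, μ ∈ κ ∧ IsOrd μ ∧ ¬ Fn K μ μ ∧ ∀ a, a ∈ μ → Fn K a a) ∧
  ∃ r, (∀ q, q ∈ r ↔ ∃ x, x ∈ v ∧ ∃ y, Fn K x y ∧ IsOPair q x y) ∧ Fn K r s

variable {V : Type u} [Membership V V] {lam Hs : V}

theorem defH_isEmbeddingGraph {C : Type} (K : C) :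
    DefH fun (W : C → Set (HSet lam)) _ => IsEmbeddingGraph (W K) := by
  unfold IsEmbeddingGraph
  infer_instance

/-- Layout: the set variables 0, 1, 2 are κ, v, s and the tags start at 3. The given classes are the
`c` small classes followed by their `c` images; the three existential classes are K, Z, Z'. -/
theorem defH_isReflection (c : ℕ) :
    DefH fun (W : Fin (c + c) ⊕ Fin 3 → Set (HSet lam)) w =>
      IsReflection (fun i : Fin 8 => w (i.1 + 3)) (w 0) (w 1) (w 2)
        (fun i => W (Sum.inl (Fin.castAdd c i))) (fun i => W (Sum.inl (Fin.natAdd c i)))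
        (W (Sum.inr 0)) (W (Sum.inr 1)) (W (Sum.inr 2)) := by
  have := defH_isEmbeddingGraph (lam := lam) (C := Fin (c + c) ⊕ Fin 3) (Sum.inr 0)
  unfold IsReflection
  infer_instance

end Reflection
end SetAction

/-! ### The reflection argument. -/

namespace SetAction

universe u v

set_option synthInstance.maxSize 100000
set_option synthInstance.maxHeartbeats 400000

variable {V : Type u} [Membership V V] {lam Hs : V}

namespace Ctx

variable (h : Ctx lam Hs)
include h

theorem class_ext {X Y : HClass lam} (e : X.carrier = Y.carrier) : X = Y :=
  Subtype.ext (h.zf.ext _ _ fun z =>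
    ⟨fun hz => (Set.ext_iff.1 e ⟨z, X.2 z hz⟩).1 hz, fun hz => (Set.ext_iff.1 e ⟨z, Y.2 z hz⟩).2 hz⟩)

theorem exists_map_of_graph {K : HClass lam} (hK : IsEmbeddingGraph K.carrier) :
    ∃ k : HSet lam → HSet lam, IsInternal k ∧ ∀ x y : HSet lam, Fn K.carrier x y ↔ y = k x := by
  choose k hk hk' using hK.2.1
  have hfn : ∀ x y : HSet lam, Fn K.carrier x y ↔ y = k x := fun x y =>
    ⟨hk' x y, fun e => e ▸ hk x⟩
  refine ⟨k, ⟨K.1, fun q => ⟨fun hq => ?_, ?_⟩⟩, hfn⟩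
  · obtain ⟨x, y, e⟩ := hK.1 ⟨q, K.2 q hq⟩ hq
    obtain rfl := (hfn x y).1 ⟨_, hq, e⟩
    exact ⟨x, h.isOPair_coe.2 e⟩
  · rintro ⟨x, hx⟩
    have := (h.hadj.fn_iff).1 (hk x)
    rw [h.zf.adj.isOPair_iff.1 hx, ← h.coe_op]
    exact this

theorem isRestriction_iff {k : HSet lam → HSet lam} {v r : HSet lam} :
    IsRestriction k v r ↔
      ∀ q : HSet lam, q ∈ r ↔ ∃ x : HSet lam, x ∈ v ∧ IsOPair q x (k x) := by
  refine ⟨fun H q => (H q.1).trans (exists_congr fun x => and_congr_right fun _ => h.isOPair_coe),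
    fun H q => ⟨fun hq => ?_, ?_⟩⟩
  · obtain ⟨x, hx, e⟩ := (H ⟨q, r.2.mem hq⟩).1 hq
    exact ⟨x, hx, h.isOPair_coe.2 e⟩
  · rintro ⟨x, hx, e⟩
    rw [h.zf.adj.isOPair_iff.1 e, ← h.coe_op]
    exact (H _).2 ⟨x, hx, h.hadj.isOPair_iff.2 rfl⟩

theorem exists_isRestriction {k : HSet lam → HSet lam} (hk : IsInternal k) (v : HSet lam) :
    ∃ r : HSet lam, IsRestriction k v r := by
  obtain ⟨K, hK, -⟩ := h.exists_graph_class hk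
  have hfn : ∀ x y : HSet lam, PairMem K.1 x.1 y.1 ↔ y = k x := fun x y =>
    h.fn_coe.symm.trans (hK x y)
  obtain ⟨r, hr⟩ := h.exists_graph (fun x y => PairMem K.1 x y) (a := v.1) v.2.cardLE
    (fun x hx => v.2.mem hx) (fun x y y' hx hy hy' e e' => by
      have e₁ := (hfn ⟨x, v.2.mem hx⟩ ⟨y, hy⟩).1 e
      have e₂ := (hfn ⟨x, v.2.mem hx⟩ ⟨y', hy'⟩).1 e'
      exact congrArg Subtype.val (e₁.trans e₂.symm))
  refine ⟨r, fun q => (hr q).trans ⟨?_, ?_⟩⟩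
  · rintro ⟨x, y, hx, hy, e, hq⟩
    have e₁ := (hfn ⟨x, v.2.mem hx⟩ ⟨y, hy⟩).1 e
    refine ⟨⟨x, v.2.mem hx⟩, hx, ?_⟩
    rw [← e₁]
    exact hq
  · rintro ⟨x, hx, hq⟩
    exact ⟨x.1, (k x).1, hx, (k x).2, (hfn _ _).2 rfl, hq⟩

end Ctx

section Reflection

variable {j : HSet lam → HSet lam} {jstar : HClass lam → HClass lam} (h : Ctx lam Hs)
  (hel : IsSigma11Elementary j jstar) (hj : IsInternal j)

namespace IsSigma11Elementary

include h hel hj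

theorem carrier_jstar (p : SmallClass lam) :
    (jstar p.1).carrier = (hel.toEmb hj).act p := by
  ext y
  exact (mem_jstar_iff h hel hj p.2).trans (Emb.mem_act (k := hel.toEmb hj) (p := p)).symm

/-- Needed so that `mem_jstar_iff` applies a second time, to `jstar p`. -/
theorem jstar_small (p : SmallClass lam) :
    ∃ l : V, IsSuccCardinal lam l ∧ CardLE (jstar p.1).1 l := by
  obtain ⟨q, hq⟩ := h.exists_act_eq (hel.toEmb hj) p
  rw [h.class_ext ((carrier_jstar h hel hj p).trans hq)]
  exact q.2

omit hj in
theorem isEmbeddingGraph {J : HClass lam}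
    (hJ : ∀ x y : HSet lam, Fn J.carrier x y ↔ y = j x)
    (hJ' : ∀ q : HSet lam, q ∈ J.carrier → ∃ x y : HSet lam, IsOPair q x y) :
    IsEmbeddingGraph J.carrier := by
  refine ⟨hJ', fun x => ⟨j x, (hJ _ _).2 rfl, fun z hz => (hJ _ _).1 hz⟩, ?_, ?_, ?_⟩
  · intro x x' y hx hx'
    exact hel.eq_iff.2 (((hJ _ _).1 hx).symm.trans ((hJ _ _).1 hx'))
  · intro x y hx hy
    rw [h.hadj.eq_empty hx, hJ, map_empty h hel] at hy
    rw [hy]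
    exact h.hadj.notMem_empty
  · intro s t u s' t' u' hu hs ht hu'
    rw [h.hadj.eq_insert hu, hJ, map_insert h hel, ← (hJ _ _).1 hs, ← (hJ _ _).1 ht] at hu'
    rw [hu']
    exact fun z => h.hadj.mem_insert

theorem exists_isReflection {c : ℕ} (p : Fin c → SmallClass lam) {κ v s : HSet lam}
    (hκ : IsCrit j κ) (hv : j v = v) (hs : IsRestriction j v s) :
    ∃ K Z Z' : HClass lam, IsReflection (fun i : Fin 8 => h.hadj.numeral i.1) κ v s
      (fun i => (p i).carrier) (fun i => (hel.toEmb hj).act (p i))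
      K.carrier Z.carrier Z'.carrier := by
  let w : ℕ → HSet lam := cons κ (cons v (cons s h.hadj.numeral))
  let X : Fin (c + c) → HClass lam := Fin.append (fun i => (p i).1) fun i => jstar (p i).1
  have hP := defH_isReflection (lam := lam) c
  -- Elementarity is used downwards: what remains is the same statement about the images of all
  -- parameters.
  have key := (hel.exists_iff _ X w (hP := hP)).2 ?_
  · obtain ⟨Y, hY⟩ := key
    refine ⟨Y 0, Y 1, Y 2, ?_⟩
    simp only [Sum.elim_inl, Sum.elim_inr, X, Fin.append_left, Fin.append_right,
      carrier_jstar h hel hj] at hY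
    exact hY
  obtain ⟨J, hJ, hJ'⟩ := h.exists_graph_class hj
  let t : ℕ → HSet lam := h.hadj.numeral
  obtain ⟨Z, hZ⟩ := h.exists_fixedPoint (fun W w => TruthStep (fun i : Fin 8 => w (i.1 + 1)) (W ())
    (w 0)) t fun S T w hST => TruthStep.mono hST
  have hjt : ∀ n, j (t n) = t n :=
    h.hadj.map_numeral_of_insert (map_empty h hel) (map_insert h hel)
  have hZ' := (hel.iff (c := 1) (fun W w => ∀ u, u ∈ W 0 ↔ TruthStep (fun i : Fin 8 => w i.1) (W 0) u)
    (fun _ => Z) t).1 hZ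
  simp only [hjt] at hZ'
  -- The witness is j itself. It carries Z into `jstar Z`, again a fixed point by elementarity since
  -- the tags are fixed; allowing two truth classes avoids comparing Z with `jstar Z`.
  refine ⟨![J, Z, jstar Z], ?_⟩
  have hτ : (fun i : Fin 8 => j (w (i.1 + 3))) = fun i : Fin 8 => t i.1 :=
    funext fun i => hjt i.1
  have e₀ : j (w 0) = j κ := rfl
  have e₁ : j (w 1) = v := hv
  have e₂ : j (w 2) = j s := rfl
  beta_reduce
  rw [hτ, e₀, e₁, e₂]
  have hX : (fun i => (jstar (X (Fin.castAdd c i))).carrier) = fun i => (jstar (p i).1).carrier := by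
    simp only [X, Fin.append_left]
  have hX' : (fun i => (jstar (X (Fin.natAdd c i))).carrier) =
      fun i => (jstar (jstar (p i).1)).carrier := by
    simp only [X, Fin.append_right]
  change IsReflection _ _ _ _ (fun i => (jstar (X (Fin.castAdd c i))).carrier)
    (fun i => (jstar (X (Fin.natAdd c i))).carrier) J.carrier Z.carrier (jstar Z).carrier
  rw [hX, hX']
  refine ⟨isEmbeddingGraph h hel hJ hJ', hZ, hZ', ?_, ?_, ?_, ?_⟩
  · intro u u' hu hu'
    obtain rfl := (hJ _ _).1 hu'
    exact (hel.iff (c := 1) (fun W w => w 0 ∈ W 0) (fun _ => Z) (fun _ => u)).1 hu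
  · intro i y
    refine (mem_jstar_iff h hel hj (jstar_small h hel hj (p i))).trans ⟨?_, ?_⟩
    · rintro ⟨z, hz, hy⟩
      exact ⟨z, j z, hz, (hJ _ _).2 rfl, hy⟩
    · rintro ⟨z, z', hz, hz', hy⟩
      exact ⟨z, hz, (hJ _ _).1 hz' ▸ hy⟩
  · have ho := Ctx.isOrd_coe.1 hκ.1
    refine ⟨κ, ?_, ho, fun e => hκ.2.1 ((hJ _ _).1 e).symm, fun a ha =>
      (hJ _ _).2 (hκ.2.2 a ha).symm⟩
    rcases h.trichotomy (hel.isOrd_iff.1 ho) ho with e | e | e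
    · exact absurd e (not_map_mem h hel hj ho)
    · exact absurd e hκ.2.1
    · exact e
  -- The restriction of j to v is s, and the image parameter is j(s).
  · refine ⟨s, fun q => (h.isRestriction_iff.1 hs q).trans ?_, (hJ _ _).2 rfl⟩
    simp only [hJ]
    exact exists_congr fun x => and_congr_right fun _ =>
      ⟨fun e => ⟨_, rfl, e⟩, fun ⟨_, e, e'⟩ => e ▸ e'⟩

theorem exists_reflecting_emb (hne : j ≠ id) {c : ℕ} (p : Fin c → SmallClass lam) :
    ∃ k : Emb lam, (∀ i, k ∈ stabNhd (hel.toEmb hj) (p i)) ∧ k ≠ hel.toEmb hj ∧ CritLT k j ∧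
      ReflectsOn k j := by
  obtain ⟨κ, hκ⟩ := exists_isCrit h hel hj hne
  -- If V_λ is not in H, the last claim is vacuous and the empty set serves as a dummy fixed
  -- parameter.
  obtain ⟨v, hv, hv'⟩ : ∃ v : HSet lam, j v = v ∧ ∀ v', IsRankStage lam v'.1 → v' = v := by
    by_cases hv : ∃ v : HSet lam, IsRankStage lam v.1
    · obtain ⟨v, hv⟩ := hv
      exact ⟨v, map_rankStage h hel hj hv, fun v' hv' =>
        h.isRankStage_unique (h.isRankStage_coe hv') (h.isRankStage_coe hv)⟩
    · exact ⟨_, map_empty h hel, fun v' hv' => absurd ⟨v', hv'⟩ hv⟩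
  obtain ⟨s, hs⟩ := h.exists_isRestriction hj v
  obtain ⟨K, Z, Z', hK, hZ, hZ', hZZ', hact, ⟨μ, hμκ, hμ, hμ', hμ''⟩, r, hr, hrs⟩ :=
    exists_isReflection h hel hj p hκ hv hs
  obtain ⟨k, hk, hfn⟩ := h.exists_map_of_graph hK
  simp only [hfn] at hZZ' hact hμ' hμ'' hr hrs
  have k₀ : k h.hadj.empty = h.hadj.empty :=
    h.hadj.eq_empty (hK.2.2.2.1 _ _ h.hadj.notMem_empty ((hfn _ _).2 rfl))
  have k₁ : ∀ s t, k (h.hadj.insert s t) = h.hadj.insert (k s) (k t) := fun s t =>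
    h.hadj.eq_insert (hK.2.2.2.2 s t _ _ _ _ (fun _ => h.hadj.mem_insert) ((hfn _ _).2 rfl)
      ((hfn _ _).2 rfl) ((hfn _ _).2 rfl))
  have hinj : Function.Injective k := fun x x' e =>
    hK.2.2.1 x x' (k x) ((hfn _ _).2 rfl) ((hfn _ _).2 e)
  have hτ : Function.Injective fun i : Fin 8 => h.hadj.numeral i.1 := fun i i' e =>
    Fin.ext (h.hadj.numeral_injective e)
  have hemb : IsDelta0Embedding k := fun n φ hφ a =>
    h.hadj.realize_iff_of_truth hτ hZ hZ' hinj
      (fun i => h.hadj.map_numeral_of_insert k₀ k₁ i.1) k₀ k₁ (h.hadj.map_op_of_insert k₀ k₁)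
      (fun u hu => hZZ' u _ hu rfl) hφ a
  let k' : Emb lam := ⟨k, hk, hemb⟩
  refine ⟨k', fun i => ?_, fun e => hμ' ?_, ?_, ?_⟩
  · ext y
    refine (Emb.mem_act (k := k')).trans (Iff.trans ?_ (hact i y).symm)
    exact ⟨fun ⟨z, hz, hy⟩ => ⟨z, _, hz, rfl, hy⟩, fun ⟨z, z', hz, (hz' : z' = k z), hy⟩ =>
      ⟨z, hz, (hz' ▸ hy : y ∈ k z)⟩⟩
  · have e' : k = j := congrArg Subtype.val e
    rw [e']
    exact (hκ.2.2 μ hμκ).symm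
  · exact ⟨μ, κ, ⟨Ctx.isOrd_coe.2 hμ, fun e => hμ' e.symm, fun a ha => (hμ'' a ha).symm⟩, hκ, hμκ⟩
  · intro v' hv''
    obtain rfl := hv' v' hv''
    refine ⟨r, s, h.isRestriction_iff.2 fun q => (hr q).trans ?_, hs, hrs.symm⟩
    exact exists_congr fun x => and_congr_right fun _ =>
      ⟨fun ⟨y, (e : y = k x), e'⟩ => (e ▸ e' : IsOPair q x (k x)), fun e => ⟨_, rfl, e⟩⟩

end IsSigma11Elementary

end Reflection

/-! ### The topology induced by the action. -/

section ActionTopology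

/-- As `S` is discrete, joint continuity means continuity of each slice k ↦ f k p. The admissible
topologies are thus exactly those below the infimum of the induced ones, which is therefore the
coarsest. -/
theorem sSup_continuous_eq_iInf {E S T : Type*} (f : E → S → T) :
    sSup {t | @Continuous (E × S) T (@instTopologicalSpaceProd _ _ t ⊥) ⊥ fun x => f x.1 x.2} =
      ⨅ p, TopologicalSpace.induced (fun k => f k p) ⊥ := by
  let _ : TopologicalSpace S := ⊥
  let _ : TopologicalSpace T := ⊥
  have : DiscreteTopology S := ⟨rfl⟩
  refine le_antisymm (sSup_le fun t ht => le_iInf fun p => ?_) (le_sSup ?_)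
  · exact continuous_iff_le_induced.1
      (Continuous.comp (show Continuous fun x : E × S => f x.1 x.2 from ht)
        (Continuous.prodMk_left p))
  · let _ : TopologicalSpace E := ⨅ p, TopologicalSpace.induced (fun k => f k p) ⊥
    exact continuous_prod_of_discrete_right.2 fun p => continuous_iff_le_induced.2 (iInf_le _ p)

theorem nhds_actTopology (j : Emb lam) :
    @nhds _ (actTopology lam) j = ⨅ p : SmallClass lam, Filter.principal (stabNhd j p) := by
  rw [show actTopology lam = _ from sSup_continuous_eq_iInf fun (k : Emb lam) p => k.act p, nhds_iInf]
  refine iInf_congr fun p => ?_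
  let _ : TopologicalSpace (Set (HSet lam)) := ⊥
  have : DiscreteTopology (Set (HSet lam)) := ⟨rfl⟩
  rw [nhds_induced, nhds_discrete, ← Filter.principal_singleton, Filter.comap_principal]
  rfl

theorem isOpen_stabNhd (j : Emb lam) (p : SmallClass lam) :
    IsOpen[actTopology lam] (stabNhd j p) := by
  let _ := actTopology lam
  rw [isOpen_iff_mem_nhds]
  intro k hk
  have e : stabNhd j p = stabNhd k p := by
    unfold stabNhd
    rw [show k.act p = j.act p from hk]
  rw [nhds_actTopology, e]
  exact Filter.mem_iInf_of_mem p (Filter.mem_principal_self _)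

/-- Basic neighbourhoods are finite intersections of stabiliser classes; hence the reflection is
carried out for a finite family of small classes. -/
theorem exists_stabNhd_subset {j : Emb lam} {U : Set (Emb lam)} (hU : IsOpen[actTopology lam] U)
    (hj : j ∈ U) :
    ∃ (c : ℕ) (p : Fin c → SmallClass lam), ∀ k : Emb lam, (∀ i, k ∈ stabNhd j (p i)) → k ∈ U := by
  let _ := actTopology lam
  have := hU.mem_nhds hj
  rw [nhds_actTopology, (Filter.hasBasis_iInf_principal_finite _).mem_iff] at this
  obtain ⟨t, ht, htU⟩ := this
  obtain ⟨c, p, -, rfl⟩ := ht.fin_param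
  exact ⟨c, p, fun k hk => htU (by simpa using hk)⟩

end ActionTopology

end SetAction

theorem mainTheorem6 {V : Type*} [Membership V V] (hV : IsModelZF V)
    (lam : V) (hlam : IsInfiniteCardinal lam)
    (j : HSet lam → HSet lam) (jstar : HClass lam → HClass lam)
    (hj : IsInternal j) (hne : j ≠ id) (hel : IsSigma11Elementary j jstar) :
    (∀ (k : Emb lam) (p : SmallClass lam), ∃ q : SmallClass lam, k.act p = q.carrier) ∧
    (∀ p : SmallClass lam,
      IsOpen[actTopology lam] (stabNhd (hel.toEmb hj) p) ∧
      ∃ k ∈ stabNhd (hel.toEmb hj) p,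
        k ≠ hel.toEmb hj ∧ CritLT k j ∧ ReflectsOn k j) ∧
    (∀ U : Set (Emb lam), IsOpen[actTopology lam] U → hel.toEmb hj ∈ U →
      ∃ k ∈ U, k ≠ hel.toEmb hj ∧ CritLT k j ∧ ReflectsOn k j) ∧
    ¬ @DiscreteTopology (Emb lam) (actTopology lam) := by
  obtain ⟨Hs, h⟩ := exists_ctx hV hlam hj
  have hU : ∀ U : Set (Emb lam), IsOpen[actTopology lam] U → hel.toEmb hj ∈ U →
      ∃ k ∈ U, k ≠ hel.toEmb hj ∧ CritLT k j ∧ ReflectsOn k j := by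
    intro U hU hjU
    obtain ⟨c, p, hp⟩ := exists_stabNhd_subset hU hjU
    obtain ⟨k, hk, H⟩ := hel.exists_reflecting_emb h hj hne p
    exact ⟨k, hp k hk, H⟩
  refine ⟨h.exists_act_eq, fun p => ⟨isOpen_stabNhd _ p, hU _ (isOpen_stabNhd _ p) rfl⟩, hU,
    fun hd => ?_⟩
  -- In a discrete topology {j} would be an open set, yet it contains no k ≠ j.
  obtain ⟨k, hk, hne, -⟩ := hU {hel.toEmb hj} (@isOpen_discrete _ (actTopology lam) hd _) rfl
  exact hne hk
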